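/- Let $(B,\nu)$ be a standard Borel probability space and let $\mathcal R\subset B\times B$ be a Borel equivalence relation with countable classes. Assume that $\nu$ is $\mathcal R$-invariant: for every Borel set $E\subset\mathcal R$, $\int_B |\{b' : (b,b')\in E\}|\,d\nu(b)=\int_B |\{b : (b,b')\in E\}|\,d\nu(b')$. Let $\mathcal F=(\mathcal F_n)_{n\in\mathbb N}$ be a sequence of maps from $B$ to the set of finite subsets of $B$ such that for each $n$ the set $\{(b,b') : b'\in\mathcal F_n(b)\}$ is a Borel subset of $\mathcal R$. Assume that: 1. $\mathcal F$ is asymptotically invariant (Følner): there is a countable set $\Phi$ of Borel bijections of $B$ with Borel inverse and graph contained in $\mathcal R$, such that for $\nu$-a.e. $b$ and every $b'$ with $(b,b')\in\mathcal R$ some $\phi$ in the group generated by $\Phi$ satisfies $\phi(b)=b'$, and such that for every $\phi\in\Phi$ and $\nu$-a.e. $b$, $\lim_{n\to\infty}|\mathcal F_n(b)\,\Delta\,\phi(\mathcal F_n(b))|/|\mathcal F_n(b)|=0$; 2. $\mathcal F$ is non-shrinking: there is a constant $C_s>0$ such that for every Borel set $Y\subset B$ and every bounded measurable $\rho:Y\to\mathbb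 N$, $\nu\bigl(\bigcup_{y\in Y}\mathcal F_{\rho(y)}(y)\bigr)\ge C_s\,\nu(Y)$; 3. $\mathcal F$ is doubling: there is a constant $C_d>0$ such that for $\nu$-a.e. $b$ and every $n\in\mathbb N$, $\bigl|\bigcup\{\mathcal F_m(b') : b'\in B,\ m\le n,\ \mathcal F_m(b')\cap\mathcal F_n(b)\ne\emptyset\}\bigr|\le C_d\,|\mathcal F_n(b)|$. Then for every (real- or complex-valued) $f\in L^1(B,\nu)$ the averages $$\mathbb A_n[\mathcal F;f](b)=\frac1{|\mathcal F_n(b)|}\sum_{b'\in\mathcal F_n(b)}f(b')$$ are integrable and converge, as $n\to\infty$, $\nu$-almost everywhere and in $L^1$-norm to $\mathbb E[f\mid\mathcal R]$, the conditional expectation of $f$ with respect to $\nu$ and the $\sigma$-algebra of $\mathcal R$-invariant Borel sets, that is, of Borel sets $E\subset B$ such that $b\in E$ and $(b,b')\in\mathcal R$ imply $b'\in E$. (By 2, $\mathcal F_n(b)\neq\emptyset$ for every $n$ and $\nu$-a.e. $b$, so the quotients above make sense almost everywhere.) -/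

import Mathlib

open MeasureTheory Filter Topology
open scoped ENNReal

namespace ErgodicRel

variable {B : Type*} [MeasurableSpace B]

/-- A countable Borel equivalence relation: the relation is a Borel subset of `B × B` and all its
equivalence classes are countable. -/
structure IsCountableBorel (R : Setoid B) : Prop where
  measurableSet_graph : MeasurableSet {p : B × B | R.r p.1 p.2}
  countable_class : ∀ b, {b' | R.r b b'}.Countable

/-- The measure `ν` is `R`-invariant: `ν × c` and `c × ν` (with `c` the counting measure on `B`)
have the same restriction to `R`. As `c` is not s-finite in general, the two products are written
out on the Borel subsets `E` of `R`: `(ν × c)(E) = ∫ c {b' | (b, b') ∈ E} dν(b)` and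
`(c × ν)(E) = ∫ c {b' | (b', b) ∈ E} dν(b)`. -/
def IsInvariantMeasure (R : Setoid B) (ν : Measure B) : Prop :=
  ∀ E : Set (B × B), MeasurableSet E → (∀ p ∈ E, R.r p.1 p.2) →
    ∫⁻ b, Measure.count {b' | (b, b') ∈ E} ∂ν = ∫⁻ b, Measure.count {b' | (b', b) ∈ E} ∂ν

/-- The group of inner automorphisms of `R`: the Borel bijections of `B` with Borel inverse
whose graph is contained in `R`. -/
def Inn (R : Setoid B) : Subgroup (Equiv.Perm B) where
  carrier := {φ | Measurable φ ∧ Measurable φ.symm ∧ ∀ b, R.r b (φ b)}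
  mul_mem' := by
    rintro φ ψ ⟨h1, h2, h3⟩ ⟨k1, k2, k3⟩
    exact ⟨h1.comp k1, k2.comp h2, fun b => R.iseqv.trans (k3 b) (h3 (ψ b))⟩
  one_mem' := ⟨measurable_id, measurable_id, fun b => R.iseqv.refl b⟩
  inv_mem' := by
    rintro φ ⟨h1, h2, h3⟩
    refine ⟨h2, h1, fun b => R.iseqv.symm ?_⟩
    have h := h3 (φ.symm b)
    rwa [Equiv.apply_symm_apply] at h

/-- The set `Φ` generates `R` with respect to `ν`: for `ν × c`-almost every `(b, b') ∈ R` some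
element of the group generated by `Φ` maps `b` to `b'`. (A subset of `B × B` is `ν × c`-null
exactly when its section over `ν`-almost every `b` has counting measure zero, i.e. is empty.) -/
def Generates (R : Setoid B) (ν : Measure B) (Φ : Set (Equiv.Perm B)) : Prop :=
  ∀ᵐ b ∂ν, ∀ b', R.r b b' → ∃ φ ∈ Subgroup.closure Φ, φ b = b'

/-- A sequence of maps from `B` to its finite subsets such that each
`{(b, b') | b' ∈ F n b}` is a Borel subset of `R`. -/
structure IsBorelFamily (R : Setoid B) (F : ℕ → B → Finset B) : Prop where
  measurableSet_graph : ∀ n, MeasurableSet {p : B × B | p.2 ∈ F n p.1}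
  subset_rel : ∀ n b, ∀ b' ∈ F n b, R.r b b'

/-- Asymptotic invariance (the Følner property). -/
def IsAsymptoticallyInvariant (R : Setoid B) (ν : Measure B) (F : ℕ → B → Finset B) : Prop :=
  ∃ Φ : Set (Equiv.Perm B), Φ.Countable ∧ (∀ φ ∈ Φ, φ ∈ Inn R) ∧ Generates R ν Φ ∧
    ∀ φ ∈ Φ, ∀ᵐ b ∂ν, Tendsto
      (fun n => ((symmDiff (F n b : Set B) (φ '' (F n b : Set B))).ncard : ℝ) / (F n b).card)
      atTop (𝓝 0)

/-- The non-shrinking property. -/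
def IsNonShrinking (ν : Measure B) (F : ℕ → B → Finset B) : Prop :=
  ∃ C : ℝ, 0 < C ∧ ∀ Y : Set B, MeasurableSet Y → ∀ ρ : Y → ℕ, Measurable ρ →
    (∃ N, ∀ y, ρ y ≤ N) → ENNReal.ofReal C * ν Y ≤ ν (⋃ y : Y, (F (ρ y) y : Set B))

/-- The union of all `F m b'` with `m ≤ n` that meet `F n b`. -/
def touchingUnion (F : ℕ → B → Finset B) (n : ℕ) (b : B) : Set B :=
  {x | ∃ m ≤ n, ∃ b', ((F m b' : Set B) ∩ F n b).Nonempty ∧ x ∈ F m b'}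

/-- The doubling condition. -/
def IsDoubling (ν : Measure B) (F : ℕ → B → Finset B) : Prop :=
  ∃ C : ℝ, 0 < C ∧ ∀ᵐ b ∂ν, ∀ n, (touchingUnion F n b).Finite ∧
    ((touchingUnion F n b).ncard : ℝ) ≤ C * (F n b).card

/-- The averages `A_n[F; f](b)`. -/
noncomputable def average {𝕜 : Type*} [RCLike 𝕜] (F : ℕ → B → Finset B) (f : B → 𝕜) (n : ℕ)
    (b : B) : 𝕜 :=
  ((F n b).card : 𝕜)⁻¹ * ∑ b' ∈ F n b, f b'

/-- The σ-algebra of `R`-invariant Borel sets. -/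
@[reducible] def invariantSigma (R : Setoid B) : MeasurableSpace B where
  MeasurableSet' E := MeasurableSet E ∧ ∀ b b', R.r b b' → b ∈ E → b' ∈ E
  measurableSet_empty := ⟨MeasurableSet.empty, fun _ _ _ h => h⟩
  measurableSet_compl := fun E hE =>
    ⟨hE.1.compl, fun b b' h hb hb' => hb (hE.2 b' b (R.iseqv.symm h) hb')⟩
  measurableSet_iUnion := fun E hE => by
    refine ⟨MeasurableSet.iUnion fun i => (hE i).1, fun b b' h hb => ?_⟩
    obtain ⟨i, hi⟩ := Set.mem_iUnion.1 hb
    exact Set.mem_iUnion.2 ⟨i, (hE i).2 b b' h hi⟩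

/-- The invariant σ-algebra is a sub-σ-algebra of the Borel σ-algebra, so that conditional
expectations with respect to it are the genuine ones. -/
theorem invariantSigma_le (R : Setoid B) : invariantSigma R ≤ ‹MeasurableSpace B› :=
  fun _ hE => hE.1

end ErgodicRel

/-! ### Enumerating classes by measure preserving automorphisms -/

namespace ErgodicRel

variable {B : Type*} [MeasurableSpace B]

/-! The strategy is the classical one: a maximal inequality reduces convergence for all integrable
functions to convergence on a dense class, and a Hilbert space argument supplies that class.

The group generated by `Φ` is countable and acts by measure preserving maps, so on a conull
invariant set every class is a single countable orbit. This makes quantifiers and sums over classes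
measurable and yields mass transport, `lintegral_tsum_comm`: for a nonnegative Borel kernel on `R`,
total mass sent equals total mass received.

For the maximal inequality, choose for each bad point a set with large average. A Borel Vitali
argument (`exists_coloring`, `exists_disjoint_subfamily`) selects disjoint sets such that every
chosen set touches a selected one of at least its index. Non-shrinking bounds the measure of the bad
points by that of the union of the chosen sets; doubling bounds this union by the selected sets, and
mass transport bounds their total by the integral of the function. Non-shrinking and doubling also
make the averaging operators uniformly bounded on L¹ (`lintegral_average_le`): the dual weights, the
sums of `1/|F n y|` over all `y` with `x ∈ F n y`, are essentially bounded.

Hence convergence is stable under L¹ limits. It holds for invariant functions trivially and for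
bounded coboundaries `q - q ∘ φ` by the Følner condition. In L², a vector orthogonal to all
convergent functions is orthogonal to its own coboundaries, hence invariant, hence convergent, hence
zero. So all of L² converges, and L² is dense in L¹. -/

/-- A measurable conull `R`-invariant set `G` on which the classes of `R` are enumerated by a
sequence `g` of measure preserving Borel automorphisms with graph in `R`. -/
structure IsOrbitCover (R : Setoid B) (ν : Measure B) (g : ℕ → B ≃ᵐ B) (G : Set B) : Prop where
  measurableSet : MeasurableSet G
  ae_mem : ∀ᵐ b ∂ν, b ∈ G
  mem_of_rel : ∀ {b b'}, R.r b b' → b ∈ G → b' ∈ G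
  rel : ∀ i b, R.r b (g i b)
  exists_eq : ∀ {b b'}, b ∈ G → R.r b b' → ∃ i, g i b = b'
  measurePreserving : ∀ i, MeasurePreserving (g i) ν ν

/-- Invariance is applied to the part of the graph of `φ` ending in `A`: its sections in one
direction have counting measure `1_{φ⁻¹A}`, in the other `1_A`. -/
theorem IsInvariantMeasure.measurePreserving [StandardBorelSpace B] {R : Setoid B} {ν : Measure B}
    (hν : IsInvariantMeasure R ν) {φ : Equiv.Perm B} (hφ : φ ∈ Inn R) :
    MeasurePreserving φ ν ν := by
  obtain ⟨h1, h2, h3⟩ := hφ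
  refine ⟨h1, ?_⟩
  ext A hA
  rw [Measure.map_apply h1 hA]
  have hE : MeasurableSet {p : B × B | p.2 ∈ A ∧ p.2 = φ p.1} :=
    (measurable_snd hA).inter (measurableSet_eq_fun measurable_snd (h1.comp measurable_fst))
  have h := hν {p : B × B | p.2 ∈ A ∧ p.2 = φ p.1} hE (fun p hp => by rw [hp.2]; exact h3 _)
  have e1 : ∀ b, Measure.count {b' | (b, b') ∈ {p : B × B | p.2 ∈ A ∧ p.2 = φ p.1}}
      = (φ ⁻¹' A).indicator 1 b := by
    intro b
    by_cases hb : φ b ∈ A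
    · have : {b' | (b, b') ∈ {p : B × B | p.2 ∈ A ∧ p.2 = φ p.1}} = {φ b} := by
        ext x; constructor
        · rintro ⟨-, h⟩; exact h
        · rintro rfl; exact ⟨hb, rfl⟩
      rw [this, Measure.count_singleton, Set.indicator_of_mem (by exact hb)]; rfl
    · have : {b' | (b, b') ∈ {p : B × B | p.2 ∈ A ∧ p.2 = φ p.1}} = ∅ := by
        ext x; simp only [Set.mem_ofPred_eq, Set.mem_empty_iff_false, iff_false]
        rintro ⟨h, rfl⟩; exact hb h
      rw [this, measure_empty, Set.indicator_of_notMem (by exact hb)]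
  have e2 : ∀ b, Measure.count {b' | (b', b) ∈ {p : B × B | p.2 ∈ A ∧ p.2 = φ p.1}}
      = A.indicator 1 b := by
    intro b
    by_cases hb : b ∈ A
    · have : {b' | (b', b) ∈ {p : B × B | p.2 ∈ A ∧ p.2 = φ p.1}} = {φ.symm b} := by
        ext x; simp [hb, Equiv.eq_symm_apply, eq_comm]
      rw [this, Measure.count_singleton, Set.indicator_of_mem hb]; rfl
    · have : {b' | (b', b) ∈ {p : B × B | p.2 ∈ A ∧ p.2 = φ p.1}} = ∅ := by
        ext x; simp [hb]
      rw [this, measure_empty, Set.indicator_of_notMem hb]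
  simp only [e1, e2] at h
  rwa [lintegral_indicator_one (h1 hA), lintegral_indicator_one hA] at h

theorem countable_subgroup_closure {H : Type*} [Group H] {s : Set H} (hs : s.Countable) :
    Countable (Subgroup.closure s) := by
  have := hs.to_subtype
  have h : Countable (FreeGroup s) :=
    (Quot.mk_surjective (r := FreeGroup.Red.Step (α := s))).countable
  have e : (FreeGroup.lift ((↑) : s → H)).range = Subgroup.closure s := by
    rw [FreeGroup.range_lift_eq_closure, Subtype.range_coe]
  rw [← e]
  exact (FreeGroup.lift ((↑) : s → H)).rangeRestrict_surjective.countable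

namespace IsOrbitCover

variable {R : Setoid B} {ν : Measure B} {g : ℕ → B ≃ᵐ B} {G : Set B}

theorem measurePreserving_symm (h : IsOrbitCover R ν g G) (i : ℕ) :
    MeasurePreserving (g i).symm ν ν :=
  (h.measurePreserving i).symm (g i)

/-- The saturation of a null set is null, because on `G` it is covered by countably many measure
preserving preimages. -/
theorem ae_forall_rel (h : IsOrbitCover R ν g G) {p : B → Prop} (hp : ∀ᵐ b ∂ν, p b) :
    ∀ᵐ b ∂ν, ∀ b', R.r b b' → p b' := by
  have : ∀ᵐ b ∂ν, ∀ i, p (g i b) :=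
    ae_all_iff.2 fun i => (h.measurePreserving i).quasiMeasurePreserving.ae hp
  filter_upwards [this, h.ae_mem] with b hb hG b' hb'
  obtain ⟨i, rfl⟩ := h.exists_eq hG hb'
  exact hb i

/-- On `G` a quantifier over a class becomes a countable one over the indices of `g`; this is the
source of measurability throughout. -/
theorem measurableSet_forall_rel (h : IsOrbitCover R ν g G) {E : Set (B × B)}
    (hE : MeasurableSet E) : MeasurableSet {b | b ∈ G ∧ ∀ b', R.r b b' → (b, b') ∈ E} := by
  have : {b | b ∈ G ∧ ∀ b', R.r b b' → (b, b') ∈ E} =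
      G ∩ ⋂ i, {b | (b, g i b) ∈ E} := by
    ext b
    simp only [Set.mem_ofPred_eq, Set.mem_inter_iff, Set.mem_iInter]
    refine and_congr_right fun hG => ⟨fun hb i => hb _ (h.rel i b), fun hb b' hb' => ?_⟩
    obtain ⟨i, rfl⟩ := h.exists_eq hG hb'
    exact hb i
  rw [this]
  exact h.measurableSet.inter (MeasurableSet.iInter fun i =>
    (measurable_id.prodMk (g i).measurable) hE)

theorem measurableSet_exists_rel (h : IsOrbitCover R ν g G) {E : Set (B × B)}
    (hE : MeasurableSet E) : MeasurableSet {b | b ∈ G ∧ ∃ b', R.r b b' ∧ (b, b') ∈ E} := by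
  have : {b | b ∈ G ∧ ∃ b', R.r b b' ∧ (b, b') ∈ E} =
      G \ {b | b ∈ G ∧ ∀ b', R.r b b' → (b, b') ∈ Eᶜ} := by
    ext b
    simp only [Set.mem_ofPred_eq, Set.mem_sdiff, not_and, not_forall, Set.mem_compl_iff, not_not]
    constructor
    · rintro ⟨hG, b', h1, h2⟩; exact ⟨hG, fun _ => ⟨b', h1, h2⟩⟩
    · rintro ⟨hG, h2⟩; obtain ⟨b', h1, h2⟩ := h2 hG; exact ⟨hG, b', h1, h2⟩
  rw [this]
  exact h.measurableSet.diff (h.measurableSet_forall_rel hE.compl)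

theorem exists_restrict (h : IsOrbitCover R ν g G) {p : B → Prop} (hp : ∀ᵐ b ∂ν, p b) :
    ∃ G', IsOrbitCover R ν g G' ∧ G' ⊆ G ∧ ∀ b ∈ G', p b := by
  set A := (toMeasurable ν {b | ¬ p b})ᶜ with hA
  have hAm : MeasurableSet A := (measurableSet_toMeasurable _ _).compl
  have hA1 : ∀ᵐ b ∂ν, b ∈ A := by
    rw [ae_iff]
    simp only [hA, Set.mem_compl_iff, not_not, Set.ofPred_mem_eq, measure_toMeasurable]
    exact hp
  have hA2 : ∀ b ∈ A, p b := by
    intro b hb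
    by_contra hpb
    exact hb (subset_toMeasurable _ _ hpb)
  refine ⟨{b | b ∈ G ∧ ∀ b', R.r b b' → (b, b') ∈ (Prod.snd ⁻¹' A : Set (B × B))},
    ⟨h.measurableSet_forall_rel (measurable_snd hAm), ?_, ?_, h.rel, ?_, h.measurePreserving⟩,
    fun b hb => hb.1, fun b hb => hA2 b (hb.2 b (R.iseqv.refl b))⟩
  · filter_upwards [h.ae_mem, h.ae_forall_rel hA1] with b h1 h2
    exact ⟨h1, h2⟩
  · rintro b b' hbb' ⟨h1, h2⟩
    exact ⟨h.mem_of_rel hbb' h1, fun c hc => h2 c (R.iseqv.trans hbb' hc)⟩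
  · rintro b b' ⟨h1, -⟩ hb'
    exact h.exists_eq h1 hb'

end IsOrbitCover

/-- The maps `g i` enumerate the generated group. `G` consists of the points whose whole orbit
avoids a measurable null set containing the failures of generation; closure of the group under
products makes `G` invariant. -/
theorem exists_isOrbitCover [StandardBorelSpace B] {R : Setoid B} {ν : Measure B}
    (hν : IsInvariantMeasure R ν) {Φ : Set (Equiv.Perm B)} (hc : Φ.Countable)
    (hΦ : ∀ φ ∈ Φ, φ ∈ Inn R) (hgen : Generates R ν Φ) :
    ∃ (g : ℕ → B ≃ᵐ B) (G : Set B), IsOrbitCover R ν g G ∧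
      ∀ i, (g i).toEquiv ∈ Subgroup.closure Φ := by
  have := countable_subgroup_closure hc
  have hle : Subgroup.closure Φ ≤ Inn R := (Subgroup.closure_le _).2 hΦ
  obtain ⟨e, he⟩ := exists_surjective_nat (Subgroup.closure Φ)
  let g : ℕ → B ≃ᵐ B := fun i =>
    ⟨(e i : Equiv.Perm B), (hle (e i).2).1, (hle (e i).2).2.1⟩
  have hmp : ∀ i, MeasurePreserving (g i) ν ν := fun i => hν.measurePreserving (hle (e i).2)
  have hrel : ∀ i b, R.r b (g i b) := fun i b => (hle (e i).2).2.2 b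
  set A := (toMeasurable ν {b | ¬ ∀ b', R.r b b' → ∃ φ ∈ Subgroup.closure Φ, φ b = b'})ᶜ with hA
  have hAm : MeasurableSet A := (measurableSet_toMeasurable _ _).compl
  have hA1 : ∀ᵐ b ∂ν, b ∈ A := by
    rw [ae_iff]
    simp only [hA, Set.mem_compl_iff, not_not, Set.ofPred_mem_eq, measure_toMeasurable]
    exact hgen
  have hA2 : ∀ b ∈ A, ∀ b', R.r b b' → ∃ i, g i b = b' := by
    intro b hb b' hb'
    by_contra hpb
    refine hb (subset_toMeasurable _ _ fun h => hpb ?_)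
    obtain ⟨φ, hφ, rfl⟩ := h b' hb'
    obtain ⟨i, hi⟩ := he ⟨φ, hφ⟩
    exact ⟨i, by change (e i : Equiv.Perm B) b = _; rw [hi]⟩
  have hone : ∃ i, ∀ b, g i b = b := by
    obtain ⟨i, hi⟩ := he 1
    exact ⟨i, fun b => by change (e i : Equiv.Perm B) b = _; rw [hi]; rfl⟩
  have hmul : ∀ i j, ∃ k, ∀ b, g k b = g i (g j b) := by
    intro i j
    obtain ⟨k, hk⟩ := he (e i * e j)
    exact ⟨k, fun b => by change (e k : Equiv.Perm B) b = _; rw [hk]; rfl⟩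
  have hsub : ∀ b ∈ ⋂ i, g i ⁻¹' A, b ∈ A := by
    intro b hb
    obtain ⟨i, hi⟩ := hone
    have := Set.mem_iInter.1 hb i
    rwa [Set.mem_preimage, hi] at this
  refine ⟨g, ⋂ i, g i ⁻¹' A, ⟨MeasurableSet.iInter fun i => (g i).measurable hAm, ?_, ?_, hrel,
    fun hb hb' => hA2 _ (hsub _ hb) _ hb', hmp⟩, fun i => (e i).2⟩
  · have : ∀ᵐ b ∂ν, ∀ i, g i b ∈ A :=
      ae_all_iff.2 fun i => (hmp i).quasiMeasurePreserving.ae hA1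
    filter_upwards [this] with b hb
    exact Set.mem_iInter.2 hb
  · intro b b' hbb' hb
    obtain ⟨j, rfl⟩ := hA2 b (hsub b hb) b' hbb'
    refine Set.mem_iInter.2 fun i => ?_
    obtain ⟨k, hk⟩ := hmul i j
    have := Set.mem_iInter.1 hb k
    rwa [Set.mem_preimage, hk] at this

/-! ### Mass transport -/

theorem tsum_indicator_comp {ι α : Type*} (a : ι → α) (s : Set ι) (hinj : Set.InjOn a s)
    (k : α → ℝ≥0∞) (hk : Function.support k ⊆ a '' s) :
    ∑' i, s.indicator (fun i => k (a i)) i = ∑' y, k y := by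
  rw [← tsum_subtype s (fun i => k (a i))]
  refine Function.Injective.tsum_eq (g := fun i : s => a i) (fun i j hij => ?_) ?_
  · exact Subtype.ext (hinj i.2 j.2 hij)
  · intro y hy
    obtain ⟨i, hi, rfl⟩ := hk hy
    exact ⟨⟨i, hi⟩, rfl⟩

namespace IsOrbitCover

variable {R : Setoid B} {ν : Measure B} {g : ℕ → B ≃ᵐ B} {G : Set B}

/-- The points at which `g i` takes a value not taken by any `g j` with `j < i`. -/
def firstHit (g : ℕ → B ≃ᵐ B) (i : ℕ) : Set B := {b | ∀ j < i, g j b ≠ g i b}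

theorem measurableSet_firstHit [StandardBorelSpace B] (g : ℕ → B ≃ᵐ B) (i : ℕ) :
    MeasurableSet (firstHit g i) := by
  have : firstHit g i = ⋂ j, ⋂ (_ : j < i), {b | g j b = g i b}ᶜ := by
    ext b; simp [firstHit]
  rw [this]
  exact MeasurableSet.iInter fun j => MeasurableSet.iInter fun _ =>
    (measurableSet_eq_fun (g j).measurable (g i).measurable).compl

theorem firstHit_unique {b : B} {i j : ℕ} (hi : b ∈ firstHit g i)
    (hj : b ∈ firstHit g j) (hij : g i b = g j b) : i = j := by
  rcases lt_trichotomy i j with h | h | h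
  · exact absurd hij (hj i h)
  · exact h
  · exact absurd hij.symm (hi j h)

theorem exists_firstHit (h : IsOrbitCover R ν g G) {b b' : B} (hb : b ∈ G) (hr : R.r b b') :
    ∃ i, b ∈ firstHit g i ∧ g i b = b' := by
  classical
  have hex := h.exists_eq hb hr
  refine ⟨Nat.find hex, fun j hj hj' => ?_, Nat.find_spec hex⟩
  exact Nat.find_min hex hj (hj'.trans (Nat.find_spec hex))

/-- Each point of the class of `b` is `g i b` for exactly one `i` with `b ∈ firstHit g i`, so the
sum over the class becomes a series of measurable terms. -/
theorem tsum_firstHit (h : IsOrbitCover R ν g G) {b : B} (hb : b ∈ G) (k : B → ℝ≥0∞)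
    (hk : ∀ b', ¬ R.r b b' → k b' = 0) :
    ∑' i, (firstHit g i).indicator (fun b => k (g i b)) b = ∑' b', k b' := by
  rw [← tsum_indicator_comp (fun i => g i b) {i | b ∈ firstHit g i} ?_ k ?_]
  · rfl
  · intro i hi j hj hij
    exact firstHit_unique hi hj hij
  · intro y hy
    by_cases hr : R.r b y
    · obtain ⟨i, h1, h2⟩ := h.exists_firstHit hb hr
      exact ⟨i, h1, h2⟩
    · exact absurd (hk y hr) hy

/-- The same decomposition of `R` into partial graphs, read from the target: each related `y` is `(g
i).symm b` for exactly one `i` with `y ∈ firstHit g i`. -/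
theorem tsum_firstHit_symm (h : IsOrbitCover R ν g G) {b : B} (hb : b ∈ G) (k : B → ℝ≥0∞)
    (hk : ∀ b', ¬ R.r b b' → k b' = 0) :
    ∑' i, (firstHit g i).indicator k ((g i).symm b) = ∑' b', k b' := by
  rw [← tsum_indicator_comp (fun i => (g i).symm b) {i | (g i).symm b ∈ firstHit g i} ?_ k ?_]
  · rfl
  · intro i hi j hj hij
    simp only at hij
    refine firstHit_unique (g := g) hi (by rw [hij]; exact hj) ?_
    rw [MeasurableEquiv.apply_symm_apply, hij, MeasurableEquiv.apply_symm_apply]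
  · intro y hy
    by_cases hr : R.r b y
    · obtain ⟨i, h1, h2⟩ := h.exists_firstHit (h.mem_of_rel hr hb) (R.iseqv.symm hr)
      have : (g i).symm b = y := by rw [← h2, MeasurableEquiv.symm_apply_apply]
      exact ⟨i, by change (g i).symm b ∈ firstHit g i; rwa [this], this⟩
    · exact absurd (hk y hr) hy

theorem measurable_tsum [StandardBorelSpace B] (h : IsOrbitCover R ν g G) {k : B → B → ℝ≥0∞}
    (hk : Measurable (Function.uncurry k)) (hR : ∀ b b', ¬ R.r b b' → k b b' = 0) :
    Measurable (G.indicator fun b => ∑' b', k b b') := by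
  have : (G.indicator fun b => ∑' b', k b b') =
      G.indicator fun b => ∑' i, (firstHit g i).indicator (fun b => k b (g i b)) b := by
    ext b
    by_cases hb : b ∈ G
    · rw [Set.indicator_of_mem hb, Set.indicator_of_mem hb, ← h.tsum_firstHit hb _ (hR b)]
      rfl
    · rw [Set.indicator_of_notMem hb, Set.indicator_of_notMem hb]
  rw [this]
  exact (Measurable.tsum fun i => (hk.comp
    (measurable_id.prodMk (g i).measurable)).indicator (measurableSet_firstHit g i)).indicator
      h.measurableSet

/-- The mass transport principle. -/
theorem lintegral_tsum_comm [StandardBorelSpace B] (h : IsOrbitCover R ν g G)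
    {k : B → B → ℝ≥0∞} (hk : Measurable (Function.uncurry k))
    (hR : ∀ b b', ¬ R.r b b' → k b b' = 0) :
    ∫⁻ b, ∑' b', k b b' ∂ν = ∫⁻ b', ∑' b, k b b' ∂ν := by
  have e1 : ∫⁻ b, ∑' b', k b b' ∂ν =
      ∫⁻ b, ∑' i, (firstHit g i).indicator (fun b => k b (g i b)) b ∂ν := by
    refine lintegral_congr_ae ?_
    filter_upwards [h.ae_mem] with b hb
    rw [← h.tsum_firstHit hb _ (hR b)]
    rfl
  have e2 : ∫⁻ b', ∑' b, k b b' ∂ν =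
      ∫⁻ b', ∑' i, (firstHit g i).indicator (fun b => k b (g i b)) ((g i).symm b') ∂ν := by
    refine lintegral_congr_ae ?_
    filter_upwards [h.ae_mem] with b hb
    rw [← h.tsum_firstHit_symm hb (fun b' => k b' b)
      (fun b' hb' => hR _ _ fun hh => hb' (R.iseqv.symm hh))]
    refine tsum_congr fun i => ?_
    simp only [Set.indicator, MeasurableEquiv.apply_symm_apply]
  have hm : ∀ i, Measurable ((firstHit g i).indicator (fun b => k b (g i b))) := fun i =>
    (hk.comp (measurable_id.prodMk (g i).measurable)).indicator (measurableSet_firstHit g i)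
  -- Both sides are now series over the partial graphs of the `g i`; corresponding terms agree since
  -- `(g i).symm` preserves the measure.
  rw [e1, e2, lintegral_tsum fun i => (hm i).aemeasurable,
    lintegral_tsum]
  rotate_left
  · exact fun i => ((hm i).comp (g i).symm.measurable).aemeasurable
  exact tsum_congr fun i => ((h.measurePreserving_symm i).lintegral_comp (hm i)).symm

/-! ### Borel colourings and a Vitali selection -/

/-- A Borel family of finite subsets of the classes splits, by a countable Borel partition of its
index set, into families of pairwise disjoint sets. -/
theorem exists_coloring [StandardBorelSpace B] (h : IsOrbitCover R ν g G) {T : B → Finset B}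
    (hT : MeasurableSet {p : B × B | p.2 ∈ T p.1}) (hTR : ∀ b, ∀ x ∈ T b, R.r b x) :
    ∃ P : ℕ → Set B, (∀ k, MeasurableSet (P k)) ∧ G ⊆ ⋃ k, P k ∧
      ∀ k, ∀ b ∈ P k, ∀ b' ∈ P k, ∀ x ∈ T b, x ∈ T b' → b = b' := by
  obtain ⟨e, he⟩ := exists_measurableEmbedding_real B
  have hem := he.measurable
  -- A colour is `(I, M, z)`: `T b` is reached by the `g i` with `i < I`; every point `(g j).symm (g
  -- i b)` with `i, j < I` other than `b` is at distance at least `1/(M+1)` from `b` in the real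
  -- line; and `b` lies in the `z`-th cell of length `1/(M+1)`. Two points of one colour with a
  -- common `x = g i b = g j b'` satisfy `b' = (g j).symm (g i b)`, and sharing a cell forces `b' =
  -- b`.
  let P : ℕ × ℕ × ℤ → Set B := fun c =>
    {b | b ∈ G ∧ ∀ x, R.r b x → (b, x) ∈ {p : B × B | p.2 ∈ T p.1 → ∃ i < c.1, g i p.1 = p.2}} ∩
    ((⋂ i ∈ Finset.range c.1, ⋂ j ∈ Finset.range c.1,
      ({b | (g j).symm (g i b) = b} ∪ {b | 1 ≤ |e ((g j).symm (g i b)) - e b| * (c.2.1 + 1)})) ∩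
      {b | ⌊e b * (c.2.1 + 1)⌋ = c.2.2})
  have hgm : ∀ i j, Measurable fun b => (g j).symm (g i b) := fun i j =>
    (g j).symm.measurable.comp (g i).measurable
  have hPm : ∀ c, MeasurableSet (P c) := by
    intro c
    refine (h.measurableSet_forall_rel ?_).inter (MeasurableSet.inter ?_ ?_)
    · have : {p : B × B | p.2 ∈ T p.1 → ∃ i < c.1, g i p.1 = p.2} =
          {p : B × B | p.2 ∈ T p.1}ᶜ ∪ ⋃ i, ⋃ (_ : i < c.1), {p : B × B | g i p.1 = p.2} := by
        ext p; simp [imp_iff_not_or]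
      rw [this]
      exact hT.compl.union (MeasurableSet.iUnion fun i => MeasurableSet.iUnion fun _ =>
        measurableSet_eq_fun ((g i).measurable.comp measurable_fst) measurable_snd)
    · refine Finset.measurableSet_biInter _ fun i _ => Finset.measurableSet_biInter _ fun j _ => ?_
      exact (measurableSet_eq_fun (hgm i j) measurable_id).union
        (measurableSet_le measurable_const
          ((((hem.comp (hgm i j)).sub hem).abs).mul_const _))
    · exact (hem.mul_const _).floor (measurableSet_singleton _)
  obtain ⟨c, hc⟩ := exists_surjective_nat (ℕ × ℕ × ℤ)
  refine ⟨fun k => P (c k), fun k => hPm _, ?_, ?_⟩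
  · intro b hb
    have h1 : ∀ x, ∃ i, x ∈ T b → g i b = x := by
      intro x
      by_cases hx : x ∈ T b
      · obtain ⟨i, hi⟩ := h.exists_eq hb (hTR b x hx)
        exact ⟨i, fun _ => hi⟩
      · exact ⟨0, fun h => absurd h hx⟩
    choose f hf using h1
    set I := (T b).sup f + 1 with hI
    have h2 : ∀ p : ℕ × ℕ, ∃ m : ℕ, (g p.2).symm (g p.1 b) = b ∨
        1 ≤ |e ((g p.2).symm (g p.1 b)) - e b| * (m + 1) := by
      intro p
      by_cases hp : (g p.2).symm (g p.1 b) = b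
      · exact ⟨0, Or.inl hp⟩
      · have hpos : 0 < |e ((g p.2).symm (g p.1 b)) - e b| :=
          abs_pos.2 (sub_ne_zero.2 fun h => hp (he.injective h))
        obtain ⟨m, hm⟩ := exists_nat_ge (1 / |e ((g p.2).symm (g p.1 b)) - e b|)
        refine ⟨m, Or.inr ?_⟩
        rw [div_le_iff₀ hpos] at hm
        nlinarith
    choose m hm using h2
    set M := (Finset.range I ×ˢ Finset.range I).sup m with hM
    obtain ⟨k, hk⟩ := hc (I, M, ⌊e b * (M + 1)⌋)
    refine Set.mem_iUnion.2 ⟨k, ?_⟩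
    simp only [hk]
    refine ⟨⟨hb, fun x _ hx => ⟨f x, ?_, hf x hx⟩⟩, ?_, rfl⟩
    · exact Nat.lt_succ_of_le (Finset.le_sup (f := f) hx)
    · simp only [Set.mem_iInter]
      intro i hi j hj
      have hle : m (i, j) ≤ M := Finset.le_sup (f := m) (Finset.mk_mem_product hi hj)
      rcases hm (i, j) with h | h
      · exact Or.inl h
      · refine Or.inr (h.trans ?_)
        have : (m (i, j) : ℝ) ≤ M := by exact_mod_cast hle
        simp only
        gcongr
  · rintro k b ⟨⟨-, hb1⟩, hb2, hb3⟩ b' ⟨⟨-, hb1'⟩, hb2', hb3'⟩ x hx hx'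
    obtain ⟨i, hi, hix⟩ := hb1 x (hTR _ _ hx) hx
    obtain ⟨j, hj, hjx⟩ := hb1' x (hTR _ _ hx') hx'
    simp only at hix hjx
    have hb' : (g j).symm (g i b) = b' := by
      rw [hix, ← hjx, MeasurableEquiv.symm_apply_apply]
    simp only [Set.mem_iInter] at hb2
    rcases hb2 i (Finset.mem_range.2 hi) j (Finset.mem_range.2 hj) with h | h
    · exact (h.symm.trans hb')
    · exfalso
      have h4 := Int.abs_sub_lt_one_of_floor_eq_floor (Eq.trans hb3' (Eq.symm hb3))
      simp only [Set.mem_ofPred_eq, hb'] at h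
      rw [← sub_mul, abs_mul, abs_of_pos (by positivity : (0 : ℝ) < (c k).2.1 + 1)] at h4
      linarith

/-- A Borel version of the Vitali covering argument, for sets `T b` that are ranked by `ρ`. -/
theorem exists_disjoint_subfamily [StandardBorelSpace B] (h : IsOrbitCover R ν g G)
    {T : B → Finset B} (hT : MeasurableSet {p : B × B | p.2 ∈ T p.1})
    (hTR : ∀ b, ∀ x ∈ T b, R.r b x) (hne : ∀ b ∈ G, (T b).Nonempty)
    {P : ℕ → Set B} (hP : ∀ k, MeasurableSet (P k))
    (hPT : ∀ k, ∀ b ∈ P k, ∀ b' ∈ P k, ∀ x ∈ T b, x ∈ T b' → b = b')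
    {D : Set B} (hD : MeasurableSet D) (hDG : D ⊆ G) {K : ℕ} (hDP : ∀ b ∈ D, ∃ k < K, b ∈ P k)
    {ρ : B → ℕ} (hρ : Measurable ρ) {N : ℕ} (hN : ∀ b ∈ D, ρ b ≤ N) :
    ∃ Y ⊆ D, MeasurableSet Y ∧ (∀ b ∈ Y, ∀ b' ∈ Y, ∀ x ∈ T b, x ∈ T b' → b = b') ∧
      ∀ b ∈ D, ∃ y ∈ Y, ρ b ≤ ρ y ∧ ∃ x ∈ T b, x ∈ T y := by
  -- Greedy selection: stage `i` treats colour `i % K` and rank `N - i / K`, so ranks decrease and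
  -- all `K` colours of one rank are exhausted before the next.
  let P' : ℕ → Set B := fun i => (D ∩ P (i % K)) ∩ {b | ρ b + i / K = N}
  have hP' : ∀ i, MeasurableSet (P' i) := fun i =>
    (hD.inter (hP _)).inter ((hρ.add_const _) (measurableSet_singleton N))
  let Q : ℕ → Set B → Set B := fun i w =>
    {b | b ∈ G ∧ ∀ z, R.r b z → (b, z) ∈ {p : B × B | p.2 ∈ T p.1 → p.2 ∉ w}} ∩ P' i
  have hQ : ∀ i w, MeasurableSet w → MeasurableSet (Q i w) := by
    intro i w hw
    refine (h.measurableSet_forall_rel ?_).inter (hP' i)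
    have : {p : B × B | p.2 ∈ T p.1 → p.2 ∉ w} = {p : B × B | p.2 ∈ T p.1}ᶜ ∪ Prod.snd ⁻¹' wᶜ := by
      ext p; simp [imp_iff_not_or]
    rw [this]
    exact hT.compl.union (measurable_snd hw.compl)
  -- `W i` is the union of the sets selected before stage `i`; a candidate is selected when its set
  -- avoids `W i`.
  obtain ⟨W, hW0, hWs⟩ : ∃ W : ℕ → Set B, W 0 = ∅ ∧ ∀ i, W (i + 1) = W i ∪
      {x | x ∈ G ∧ ∃ b, R.r x b ∧ (x, b) ∈ {p : B × B | p.2 ∈ Q i (W i) ∧ p.1 ∈ T p.2}} :=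
    ⟨fun i => Nat.rec ∅ (fun i w => w ∪
      {x | x ∈ G ∧ ∃ b, R.r x b ∧ (x, b) ∈ {p : B × B | p.2 ∈ Q i w ∧ p.1 ∈ T p.2}}) i,
      rfl, fun _ => rfl⟩
  have hWm : ∀ i, MeasurableSet (W i) := by
    intro i
    induction i with
    | zero => rw [hW0]; exact MeasurableSet.empty
    | succ i ih =>
      rw [hWs]
      exact ih.union (h.measurableSet_exists_rel
        ((measurable_snd (hQ i _ ih)).inter (measurable_swap hT)))
  have hWmem : ∀ i x, x ∈ W i ↔ ∃ j < i, ∃ b ∈ Q j (W j), x ∈ T b := by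
    intro i x
    induction i with
    | zero => simp [hW0]
    | succ i ih =>
      rw [hWs, Set.mem_union, ih]
      constructor
      · rintro (⟨j, hj, hx⟩ | ⟨-, b, -, hb, hx⟩)
        · exact ⟨j, hj.trans (Nat.lt_succ_self i), hx⟩
        · exact ⟨i, Nat.lt_succ_self i, b, hb, hx⟩
      · rintro ⟨j, hj, b, hb, hx⟩
        rcases Nat.lt_succ_iff_lt_or_eq.1 hj with hj | rfl
        · exact Or.inl ⟨j, hj, b, hb, hx⟩
        · have hr := hTR b x hx
          exact Or.inr ⟨h.mem_of_rel hr hb.1.1, b, R.iseqv.symm hr, hb, hx⟩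
  have hlt : ∀ i j, i < j → ∀ b ∈ Q i (W i), ∀ b' ∈ Q j (W j), ∀ x ∈ T b, x ∉ T b' := by
    intro i j hij b hb b' hb' x hx hx'
    exact hb'.1.2 x (hTR _ _ hx') hx' ((hWmem j x).2 ⟨i, hij, b, hb, hx⟩)
  refine ⟨⋃ i, Q i (W i), ?_, MeasurableSet.iUnion fun i => hQ i _ (hWm i), ?_, ?_⟩
  · exact Set.iUnion_subset fun i b hb => hb.2.1.1
  · intro b hb b' hb' x hx hx'
    obtain ⟨i, hi⟩ := Set.mem_iUnion.1 hb
    obtain ⟨j, hj⟩ := Set.mem_iUnion.1 hb'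
    rcases lt_trichotomy i j with hij | rfl | hij
    · exact absurd hx' (hlt i j hij b hi b' hj x hx)
    · exact hPT _ b hi.2.1.2 b' hj.2.1.2 x hx hx'
    · exact absurd hx (hlt j i hij b' hj b hi x hx')
  · intro b hb
    obtain ⟨k, hk, hbk⟩ := hDP b hb
    have hK : 0 < K := (Nat.zero_le k).trans_lt hk
    set i := (N - ρ b) * K + k with hi
    have hmod : i % K = k := by rw [hi, Nat.mul_add_mod', Nat.mod_eq_of_lt hk]
    have hdiv : i / K = N - ρ b := by
      rw [hi, mul_comm, Nat.mul_add_div hK, Nat.div_eq_of_lt hk, add_zero]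
    have hρN := hN b hb
    have hbi : b ∈ P' i := by
      refine ⟨⟨hb, by rwa [hmod]⟩, ?_⟩
      simp only [Set.mem_ofPred_eq, hdiv]; omega
    by_cases hbQ : b ∈ Q i (W i)
    · obtain ⟨x, hx⟩ := hne b (hDG hb)
      exact ⟨b, Set.mem_iUnion.2 ⟨i, hbQ⟩, le_rfl, x, hx, hx⟩
    · have : ∃ z ∈ T b, z ∈ W i := by
        by_contra! hcon
        exact hbQ ⟨⟨hDG hb, fun z _ hz => hcon z hz⟩, hbi⟩
      obtain ⟨z, hz, hzW⟩ := this
      -- A rejected point meets a set selected at an earlier stage `j < i`, whose rank is therefore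
      -- at least as large.
      obtain ⟨j, hj, y, hy, hzy⟩ := (hWmem i z).1 hzW
      refine ⟨y, Set.mem_iUnion.2 ⟨j, hy⟩, ?_, z, hz, hzy⟩
      have h1 : ρ y + j / K = N := hy.2.2
      have h2 : j / K ≤ i / K := Nat.div_le_div_right hj.le
      omega

end IsOrbitCover

/-! ### Regular families and the maximal inequality -/

theorem tsum_indicator_finset {α : Type*} (s : Finset α) (u : α → ℝ≥0∞) :
    ∑' x, (s : Set α).indicator u x = ∑ x ∈ s, u x := by
  rw [tsum_eq_sum (s := s) fun x hx => Set.indicator_of_notMem (by simpa using hx) _]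
  exact Finset.sum_congr rfl fun x hx => Set.indicator_of_mem (by simpa using hx) _

theorem IsOrbitCover.measurable_sum_finset [StandardBorelSpace B] {R : Setoid B} {ν : Measure B}
    {g : ℕ → B ≃ᵐ B} {G : Set B} (h : IsOrbitCover R ν g G) {T : B → Finset B}
    (hT : MeasurableSet {p : B × B | p.2 ∈ T p.1}) (hTR : ∀ b, ∀ x ∈ T b, R.r b x)
    {u : B → ℝ≥0∞} (hu : Measurable u) : Measurable (G.indicator fun b => ∑ x ∈ T b, u x) := by
  have := h.measurable_tsum
    (k := fun b x => {p : B × B | p.2 ∈ T p.1}.indicator (fun p => u p.2) (b, x))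
    ((hu.comp measurable_snd).indicator hT) (fun b b' hb =>
      Set.indicator_of_notMem (fun hm => hb (hTR _ _ hm)) _)
  convert this using 3 with b
  rw [← tsum_indicator_finset]
  rfl

/-- Each `y` sends unit mass along its section of `E`; every point of the union of the sections
receives at least 1, so mass transport gives the bound. -/
theorem IsOrbitCover.measure_exists_le [StandardBorelSpace B] {R : Setoid B} {ν : Measure B}
    {g : ℕ → B ≃ᵐ B} {G : Set B} (h : IsOrbitCover R ν g G) {E : Set (B × B)}
    (hE : MeasurableSet E) (hER : ∀ p ∈ E, R.r p.1 p.2) :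
    ν {x | ∃ y, (y, x) ∈ E} ≤ ∫⁻ y, ∑' x, E.indicator 1 (y, x) ∂ν := by
  rw [h.lintegral_tsum_comm (k := fun y x => E.indicator 1 (y, x))
    (measurable_one.indicator hE)
    (fun b b' hb => Set.indicator_of_notMem (fun hm => hb (hER _ hm)) _)]
  set S := {x | x ∈ G ∧ ∃ y, R.r x y ∧ (x, y) ∈ Prod.swap ⁻¹' E}
  have hS : MeasurableSet S := h.measurableSet_exists_rel (measurable_swap hE)
  calc ν {x | ∃ y, (y, x) ∈ E} ≤ ν S := by
        refine measure_mono_ae ?_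
        filter_upwards [h.ae_mem] with x hx hxE
        obtain ⟨y, hy⟩ := hxE
        exact ⟨hx, y, R.iseqv.symm (hER _ hy), hy⟩
    _ = ∫⁻ x, S.indicator 1 x ∂ν := (lintegral_indicator_one hS).symm
    _ ≤ _ := by
        refine lintegral_mono fun x => ?_
        by_cases hx : x ∈ S
        · obtain ⟨-, y, -, hy⟩ := hx
          have hy' : (y, x) ∈ E := hy
          refine le_trans ?_ (ENNReal.le_tsum y)
          rw [Set.indicator_of_mem hy']
          exact Set.indicator_le_self _ _ _
        · rw [Set.indicator_of_notMem hx]; exact zero_le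

/-- A Borel family of nonempty sets that is non-shrinking and, at every point of a conull invariant
set `G`, doubling. -/
structure IsRegularFamily (R : Setoid B) (ν : Measure B) (g : ℕ → B ≃ᵐ B) (G : Set B)
    (F : ℕ → B → Finset B) (Cs Cd : ℝ≥0∞) : Prop where
  cover : IsOrbitCover R ν g G
  family : IsBorelFamily R F
  nonempty : ∀ b ∈ G, ∀ n, (F n b).Nonempty
  doubling : ∀ b ∈ G, ∀ n, ∑' x, (touchingUnion F n b).indicator 1 x ≤ Cd * (F n b).card
  nonshrinking : ∀ Y : Set B, MeasurableSet Y → ∀ ρ : B → ℕ, Measurable ρ →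
    (∃ N, ∀ y ∈ Y, ρ y ≤ N) → Cs * ν Y ≤ ν (⋃ y ∈ Y, (F (ρ y) y : Set B))

namespace IsRegularFamily

variable {R : Setoid B} {ν : Measure B} {g : ℕ → B ≃ᵐ B} {G : Set B} {F : ℕ → B → Finset B}
  {Cs Cd : ℝ≥0∞}

theorem measurableSet_select (h : IsRegularFamily R ν g G F Cs Cd) {ρ : B → ℕ}
    (hρ : Measurable ρ) : MeasurableSet {p : B × B | p.2 ∈ F (ρ p.1) p.1} := by
  have : {p : B × B | p.2 ∈ F (ρ p.1) p.1} =
      ⋃ n, {p : B × B | ρ p.1 = n} ∩ {p : B × B | p.2 ∈ F n p.1} := by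
    ext p; simp
  rw [this]
  exact MeasurableSet.iUnion fun n =>
    ((hρ.comp measurable_fst) (measurableSet_singleton n)).inter (h.family.measurableSet_graph n)

theorem rel_of_mem_touchingUnion (h : IsRegularFamily R ν g G F Cs Cd) {n : ℕ} {b x : B}
    (hx : x ∈ touchingUnion F n b) : R.r b x := by
  obtain ⟨m, -, b', ⟨z, hz, hz'⟩, hx⟩ := hx
  have h1 := h.family.subset_rel n b z hz'
  have h2 := h.family.subset_rel m b' z hz
  have h3 := h.family.subset_rel m b' x hx
  exact R.iseqv.trans h1 (R.iseqv.trans (R.iseqv.symm h2) h3)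

/-- The centre `b'` and the contact point of a touching set lie in the class of `b`, so both may be
written as `g i b` and `g j b`. -/
theorem measurableSet_touchingUnion (h : IsRegularFamily R ν g G F Cs Cd) {Y : Set B}
    (hY : MeasurableSet Y) (hYG : Y ⊆ G) {ρ : B → ℕ} (hρ : Measurable ρ) :
    MeasurableSet {p : B × B | p.1 ∈ Y ∧ p.2 ∈ touchingUnion F (ρ p.1) p.1} := by
  have : {p : B × B | p.1 ∈ Y ∧ p.2 ∈ touchingUnion F (ρ p.1) p.1} =
      Prod.fst ⁻¹' Y ∩ ⋃ n, ({p : B × B | ρ p.1 = n} ∩ ⋃ m, ⋃ (_ : m ≤ n), ⋃ i, ⋃ j,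
        ({p : B × B | g j p.1 ∈ F m (g i p.1)} ∩ {p : B × B | g j p.1 ∈ F n p.1} ∩
          {p : B × B | p.2 ∈ F m (g i p.1)})) := by
    ext ⟨b, x⟩
    simp only [Set.mem_inter_iff, Set.mem_preimage, Set.mem_iUnion, Set.mem_ofPred_eq,
      exists_prop, exists_eq_left']
    refine and_congr_right fun hb => ⟨?_, ?_⟩
    · rintro ⟨m, hm, b', ⟨z, hz, hz'⟩, hx⟩
      have h1 := h.family.subset_rel _ b z hz'
      have h2 := h.family.subset_rel m b' z hz
      obtain ⟨j, rfl⟩ := h.cover.exists_eq (hYG hb) h1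
      obtain ⟨i, rfl⟩ := h.cover.exists_eq (hYG hb) (R.iseqv.trans h1 (R.iseqv.symm h2))
      exact ⟨m, hm, i, j, ⟨hz, hz'⟩, hx⟩
    · rintro ⟨m, hm, i, j, ⟨hz, hz'⟩, hx⟩
      exact ⟨m, hm, g i b, ⟨g j b, hz, hz'⟩, hx⟩
  rw [this]
  refine (measurable_fst hY).inter (MeasurableSet.iUnion fun n =>
    ((hρ.comp measurable_fst) (measurableSet_singleton n)).inter
    (MeasurableSet.iUnion fun m => MeasurableSet.iUnion fun _ => MeasurableSet.iUnion fun i =>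
      MeasurableSet.iUnion fun j => (MeasurableSet.inter ?_ ?_).inter ?_))
  · exact (((g i).measurable.comp measurable_fst).prodMk ((g j).measurable.comp measurable_fst))
      (h.family.measurableSet_graph m)
  · exact (measurable_fst.prodMk ((g j).measurable.comp measurable_fst))
      (h.family.measurableSet_graph n)
  · exact (((g i).measurable.comp measurable_fst).prodMk measurable_snd)
      (h.family.measurableSet_graph m)

/-- After Vitali selection of `Y`, the sets chosen over `D` lie in the touching unions of the points
of `Y`. Non-shrinking and doubling give `Cs ν(D) ≤ Cd ∫_Y |F (ρ y) y|`; the lower bound on the sums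
of `u`, and disjointness of the selected sets through mass transport, turn `c` times the last
integral into at most `∫ u`. -/
theorem mul_measure_le_of_select [StandardBorelSpace B] (h : IsRegularFamily R ν g G F Cs Cd)
    {u : B → ℝ≥0∞} (hu : Measurable u) (c : ℝ≥0∞) {ρ : B → ℕ} (hρ : Measurable ρ) {D : Set B}
    (hD : MeasurableSet D) (hDG : D ⊆ G) {N : ℕ} (hN : ∀ b ∈ D, ρ b ≤ N)
    (hDu : ∀ b ∈ D, c * (F (ρ b) b).card ≤ ∑ x ∈ F (ρ b) b, u x) :
    c * (Cs * ν D) ≤ Cd * ∫⁻ b, u b ∂ν := by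
  have hT := h.measurableSet_select hρ
  have hTR : ∀ b, ∀ x ∈ F (ρ b) b, R.r b x := fun b => h.family.subset_rel _ b
  obtain ⟨P, hPm, hPG, hP⟩ := h.cover.exists_coloring hT hTR
  -- The greedy selection handles only finitely many colours per rank; the general case follows by
  -- continuity from below.
  have key : ∀ K, c * (Cs * ν (D ∩ ⋃ k < K, P k)) ≤ Cd * ∫⁻ b, u b ∂ν := by
    intro K
    set D' := D ∩ ⋃ k < K, P k with hD'
    have hD'm : MeasurableSet D' :=
      hD.inter (MeasurableSet.iUnion fun k => MeasurableSet.iUnion fun _ => hPm k)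
    have hD'P : ∀ b ∈ D', ∃ k < K, b ∈ P k := by
      intro b hb
      simpa using hb.2
    obtain ⟨Y, hYD, hYm, hYdisj, hYcov⟩ := h.cover.exists_disjoint_subfamily hT hTR
      (fun b hb => h.nonempty b hb _) hPm hP hD'm (Set.inter_subset_left.trans hDG) hD'P hρ
      (fun b hb => hN b hb.1)
    have hYG : Y ⊆ G := fun y hy => hDG (hYD hy).1
    set E := {p : B × B | p.1 ∈ Y ∧ p.2 ∈ touchingUnion F (ρ p.1) p.1} with hE
    have hEm : MeasurableSet E := h.measurableSet_touchingUnion hYm hYG hρ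
    set k : B → B → ℝ≥0∞ := fun y x =>
      {p : B × B | p.1 ∈ Y ∧ p.2 ∈ F (ρ p.1) p.1}.indicator (fun p => u p.2) (y, x) with hk
    have hkm : Measurable (Function.uncurry k) :=
      (hu.comp measurable_snd).indicator ((measurable_fst hYm).inter hT)
    have hk1 : ∀ y ∈ Y, ∑' x, k y x = ∑ x ∈ F (ρ y) y, u x := by
      intro y hy
      rw [← tsum_indicator_finset]
      refine tsum_congr fun x => ?_
      by_cases hx : x ∈ F (ρ y) y <;> simp [hk, Set.indicator, hy, hx]
    have hk2 : ∀ x, ∑' y, k y x ≤ u x := by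
      intro x
      by_cases hx : ∃ y ∈ Y, x ∈ F (ρ y) y
      · obtain ⟨y, hy, hyx⟩ := hx
        rw [tsum_eq_single y]
        · exact Set.indicator_le_self' (fun _ _ => zero_le) _
        · intro y' hy'
          refine Set.indicator_of_notMem ?_ _
          rintro ⟨h1, h2⟩
          exact hy' (hYdisj y' h1 y hy x h2 hyx)
      · have : ∀ y, k y x = 0 := fun y =>
          Set.indicator_of_notMem (fun hy => hx ⟨y, hy.1, hy.2⟩) _
        simp [this]
    have step1 : Cs * ν D' ≤ ∫⁻ y, ∑' x, E.indicator 1 (y, x) ∂ν := by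
      refine (h.nonshrinking D' hD'm ρ hρ ⟨N, fun y hy => hN y hy.1⟩).trans
        ((measure_mono ?_).trans (h.cover.measure_exists_le hEm
          (fun p hp => h.rel_of_mem_touchingUnion hp.2)))
      intro x hx
      simp only [Set.mem_iUnion] at hx
      obtain ⟨b, hb, hx⟩ := hx
      obtain ⟨y, hy, hle, z, hz, hz'⟩ := hYcov b hb
      exact ⟨y, hy, ρ b, hle, b, ⟨z, hz, hz'⟩, hx⟩
    have step2 : ∀ y, c * ∑' x, E.indicator 1 (y, x) ≤ Cd * ∑' x, k y x := by
      intro y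
      by_cases hy : y ∈ Y
      · have : ∀ x, E.indicator (1 : B × B → ℝ≥0∞) (y, x) =
            (touchingUnion F (ρ y) y).indicator 1 x := by
          intro x
          by_cases hx : x ∈ touchingUnion F (ρ y) y <;> simp [hE, Set.indicator, hy, hx]
        rw [tsum_congr this, hk1 y hy]
        calc _ ≤ c * (Cd * (F (ρ y) y).card) := by gcongr; exact h.doubling y (hYG hy) _
          _ = Cd * (c * (F (ρ y) y).card) := by ring
          _ ≤ _ := by gcongr; exact hDu y (hYD hy).1
      · have : ∀ x, E.indicator (1 : B × B → ℝ≥0∞) (y, x) = 0 := fun x =>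
          Set.indicator_of_notMem (fun hm => hy hm.1) _
        simp [this]
    calc c * (Cs * ν D') ≤ c * ∫⁻ y, ∑' x, E.indicator 1 (y, x) ∂ν := by gcongr
      _ ≤ ∫⁻ y, c * ∑' x, E.indicator 1 (y, x) ∂ν := lintegral_const_mul_le _ _
      _ ≤ ∫⁻ y, Cd * ∑' x, k y x ∂ν := lintegral_mono step2
      _ = Cd * ∫⁻ y, ∑' x, k y x ∂ν := by
          refine lintegral_const_mul'' _ ?_
          have hm := h.cover.measurable_tsum hkm (fun b b' hb =>
            Set.indicator_of_notMem (fun hm => hb (hTR _ _ hm.2)) _)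
          refine ⟨_, hm, ?_⟩
          filter_upwards [h.cover.ae_mem] with b hb
          rw [Set.indicator_of_mem hb]
      _ = Cd * ∫⁻ x, ∑' y, k y x ∂ν := by
          rw [h.cover.lintegral_tsum_comm hkm (fun b b' hb =>
            Set.indicator_of_notMem (fun hm => hb (hTR _ _ hm.2)) _)]
      _ ≤ _ := by gcongr with x; exact hk2 x
  have hmono : Monotone fun K => D ∩ ⋃ k < K, P k := by
    intro K L hKL
    refine Set.inter_subset_inter_right _ (Set.biUnion_subset_biUnion_left fun k hk => ?_)
    exact lt_of_lt_of_le hk hKL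
  have hDeq : D = ⋃ K, D ∩ ⋃ k < K, P k := by
    refine Set.Subset.antisymm (fun b hb => ?_) (Set.iUnion_subset fun _ => Set.inter_subset_left)
    obtain ⟨k, hk⟩ := Set.mem_iUnion.1 (hPG (hDG hb))
    refine Set.mem_iUnion.2 ⟨k + 1, hb, ?_⟩
    simp only [Set.mem_iUnion]
    exact ⟨k, Nat.lt_succ_self k, hk⟩
  rw [hDeq, hmono.measure_iUnion, ENNReal.mul_iSup, ENNReal.mul_iSup]
  exact iSup_le key

theorem measurableSet_average_ge [StandardBorelSpace B] (h : IsRegularFamily R ν g G F Cs Cd)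
    {u : B → ℝ≥0∞} (hu : Measurable u) (c : ℝ≥0∞) (n : ℕ) :
    MeasurableSet {b | b ∈ G ∧ c * (F n b).card ≤ ∑ x ∈ F n b, u x} := by
  have hm := fun v hv => h.cover.measurable_sum_finset (h.family.measurableSet_graph n)
    (h.family.subset_rel n) (u := v) hv
  have : {b | b ∈ G ∧ c * (F n b).card ≤ ∑ x ∈ F n b, u x} =
      G ∩ {b | c * (G.indicator (fun b => ∑ x ∈ F n b, 1) b) ≤
        G.indicator (fun b => ∑ x ∈ F n b, u x) b} := by
    ext b
    refine and_congr_right fun hb => ?_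
    simp [hb]
  rw [this]
  exact h.cover.measurableSet.inter
    (measurableSet_le ((hm (fun _ => 1) measurable_const).const_mul c) (hm u hu))

/-- The weak type (1,1) maximal inequality. -/
theorem maximal_inequality [StandardBorelSpace B] (h : IsRegularFamily R ν g G F Cs Cd)
    {u : B → ℝ≥0∞} (hu : Measurable u) (c : ℝ≥0∞) :
    c * (Cs * ν {b | b ∈ G ∧ ∃ n, c * (F n b).card ≤ ∑ x ∈ F n b, u x}) ≤
      Cd * ∫⁻ b, u b ∂ν := by
  classical
  set A : ℕ → Set B := fun n => {b | b ∈ G ∧ c * (F n b).card ≤ ∑ x ∈ F n b, u x} with hA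
  have hAm : ∀ n, MeasurableSet (A n) := h.measurableSet_average_ge hu c
  have hD : {b | b ∈ G ∧ ∃ n, c * (F n b).card ≤ ∑ x ∈ F n b, u x} = ⋃ n, A n := by
    ext b; simp [hA]
  rw [hD]
  have hex : ∀ b, ∃ n, b ∈ A n ∨ b ∉ ⋃ n, A n := by
    intro b
    by_cases hb : b ∈ ⋃ n, A n
    · obtain ⟨n, hn⟩ := Set.mem_iUnion.1 hb
      exact ⟨n, Or.inl hn⟩
    · exact ⟨0, Or.inr hb⟩
  have hDm : MeasurableSet (⋃ n, A n) := MeasurableSet.iUnion hAm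
  let ρ : B → ℕ := fun b => Nat.find (hex b)
  have hρ : Measurable ρ := measurable_find hex fun n => (hAm n).union hDm.compl
  have hρA : ∀ b ∈ ⋃ n, A n, b ∈ A (ρ b) := fun b hb =>
    (Nat.find_spec (hex b)).resolve_right (not_not.2 hb)
  -- `ρ` picks the first index with large average. Non-shrinking needs bounded `ρ`, hence the
  -- exhaustion by `ρ ≤ N`.
  have hmono : Monotone fun N => (⋃ n, A n) ∩ {b | ρ b ≤ N} := fun N M hNM =>
    Set.inter_subset_inter_right _ fun b hb => le_trans hb hNM
  have hDeq : (⋃ n, A n) = ⋃ N, (⋃ n, A n) ∩ {b | ρ b ≤ N} := by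
    rw [← Set.inter_iUnion]
    refine (Set.inter_eq_left.2 fun b _ => Set.mem_iUnion.2 ⟨ρ b, le_refl (ρ b)⟩).symm
  rw [hDeq, hmono.measure_iUnion, ENNReal.mul_iSup, ENNReal.mul_iSup]
  refine iSup_le fun N => ?_
  exact h.mul_measure_le_of_select hu c hρ (hDm.inter (measurableSet_le hρ measurable_const))
    (fun b hb => (hρA b hb.1).1) (fun b hb => hb.2) (fun b hb => (hρA b hb.1).2)

/-! ### Uniform L¹ bound for the averages -/

/-- If `S x` is a bounded Borel choice of points `y` with `x ∈ F n y`, then the total of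
`1 / |F n y|` over `S x` is almost everywhere bounded. -/
theorem measure_sum_inv_card_gt_eq_zero [StandardBorelSpace B] [IsFiniteMeasure ν]
    (h : IsRegularFamily R ν g G F Cs Cd) (hCs : Cs ≠ 0) (hCs' : Cs ≠ ∞) (n : ℕ)
    {S : B → Finset B} (hS : MeasurableSet {p : B × B | p.2 ∈ S p.1})
    (hSF : ∀ x, ∀ y ∈ S x, x ∈ F n y) {I : ℕ} (hI : ∀ x, (S x).card ≤ I) :
    ν {x | x ∈ G ∧ 2 * Cd / Cs < ∑ y ∈ S x, ((F n y).card : ℝ≥0∞)⁻¹} = 0 := by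
  have hSR : ∀ x, ∀ y ∈ S x, R.r x y := fun x y hy =>
    R.iseqv.symm (h.family.subset_rel n y x (hSF x y hy))
  set A := {x | x ∈ G ∧ 2 * Cd / Cs < ∑ y ∈ S x, ((F n y).card : ℝ≥0∞)⁻¹} with hA
  have hAm : MeasurableSet A := by
    have hv := (h.cover.measurable_sum_finset (h.family.measurableSet_graph n)
      (h.family.subset_rel n) (u := fun _ => 1) measurable_const).inv
    have hs := h.cover.measurable_sum_finset hS hSR hv
    have : A = G ∩ {x | 2 * Cd / Cs < G.indicator (fun b => ∑ x ∈ S b,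
        (G.indicator (fun b => ∑ x ∈ F n b, (1 : ℝ≥0∞)))⁻¹ x) x} := by
      ext x
      refine and_congr_right fun hx => ?_
      have : ∑ y ∈ S x, (G.indicator (fun b => ∑ x ∈ F n b, (1 : ℝ≥0∞)))⁻¹ y =
          ∑ y ∈ S x, ((F n y).card : ℝ≥0∞)⁻¹ := by
        refine Finset.sum_congr rfl fun y hy => ?_
        rw [Pi.inv_apply, Set.indicator_of_mem (h.cover.mem_of_rel (hSR x y hy) hx)]
        simp
      rw [Set.mem_ofPred_eq, Set.indicator_of_mem hx, this]
    rw [this]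
    exact h.cover.measurableSet.inter (measurableSet_lt measurable_const hs)
  obtain ⟨P, hPm, hPG, hP⟩ := h.cover.exists_coloring hS hSR
  have hAP : A ⊆ ⋃ k, A ∩ P k := by
    intro x hx
    rw [← Set.inter_iUnion]
    exact ⟨hx, hPG hx.1⟩
  refine measure_mono_null hAP (measure_iUnion_null fun k => ?_)
  -- Within one colour the sets `S x` are disjoint. With `Y` their union and `J` the integral of `|S
  -- x|` over `X`, the aim is `2 Cs J ≤ Cs J`, which forces `J = 0` because `J` is finite.
  set X := A ∩ P k with hX
  have hXm : MeasurableSet X := hAm.inter (hPm k)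
  have hXG : X ⊆ G := fun x hx => hx.1.1
  have hXn : ∀ x ∈ X, (S x).Nonempty := by
    intro x hx
    by_contra hne
    rw [Finset.not_nonempty_iff_eq_empty] at hne
    have := hx.1.2
    rw [hne, Finset.sum_empty] at this
    exact not_lt_zero this
  set Y := {y | y ∈ G ∧ ∃ x, R.r y x ∧ (y, x) ∈ {p : B × B | p.2 ∈ X ∧ p.1 ∈ S p.2}} with hY
  have hYm : MeasurableSet Y := h.cover.measurableSet_exists_rel
    ((measurable_snd hXm).inter (measurable_swap hS))
  set J := ∫⁻ x, X.indicator (fun x => ((S x).card : ℝ≥0∞)) x ∂ν with hJ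
  have step1 : J ≤ ν Y := by
    set q : B → B → ℝ≥0∞ := fun x y => {p : B × B | p.1 ∈ X ∧ p.2 ∈ S p.1}.indicator 1 (x, y)
      with hq
    have hqm : Measurable (Function.uncurry q) :=
      measurable_one.indicator ((measurable_fst hXm).inter hS)
    have hq1 : ∀ x, X.indicator (fun x => ((S x).card : ℝ≥0∞)) x = ∑' y, q x y := by
      intro x
      by_cases hx : x ∈ X
      · have : ∀ y, q x y = (S x : Set B).indicator 1 y := by
          intro y
          by_cases hy : y ∈ S x <;> simp [hq, Set.indicator, hx, hy]
        rw [tsum_congr this, tsum_indicator_finset, Set.indicator_of_mem hx]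
        simp
      · have : ∀ y, q x y = 0 := fun y => Set.indicator_of_notMem (fun hy => hx hy.1) _
        simp [this, hx]
    have hq2 : ∀ y, ∑' x, q x y ≤ Y.indicator 1 y := by
      intro y
      by_cases hy : ∃ x ∈ X, y ∈ S x
      · obtain ⟨x, hx, hxy⟩ := hy
        have hyY : y ∈ Y := ⟨h.cover.mem_of_rel (hSR x y hxy) (hXG hx), x,
          R.iseqv.symm (hSR x y hxy), hx, hxy⟩
        rw [Set.indicator_of_mem hyY, tsum_eq_single x]
        · exact Set.indicator_le_self' (fun _ _ => zero_le) _
        · intro x' hx'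
          refine Set.indicator_of_notMem ?_ _
          rintro ⟨h1, h2⟩
          exact hx' (hP k x' h1.2 x hx.2 y h2 hxy)
      · have : ∀ x, q x y = 0 := fun x =>
          Set.indicator_of_notMem (fun hx => hy ⟨x, hx.1, hx.2⟩) _
        simp [this]
    calc J = ∫⁻ x, ∑' y, q x y ∂ν := lintegral_congr hq1
      _ = ∫⁻ y, ∑' x, q x y ∂ν := h.cover.lintegral_tsum_comm hqm (fun b b' hb =>
          Set.indicator_of_notMem (fun hm => hb (hSR _ _ hm.2)) _)
      _ ≤ ∫⁻ y, Y.indicator 1 y ∂ν := lintegral_mono hq2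
      _ = ν Y := lintegral_indicator_one hYm
  set E := {p : B × B | p.1 ∈ X ∧ ∃ y ∈ S p.1, p.2 ∈ F n y} with hE
  have hEm : MeasurableSet E := by
    have : E = Prod.fst ⁻¹' X ∩ ⋃ i, ({p : B × B | g i p.1 ∈ S p.1} ∩
        {p : B × B | p.2 ∈ F n (g i p.1)}) := by
      ext ⟨x, z⟩
      simp only [hE, Set.mem_inter_iff, Set.mem_preimage, Set.mem_iUnion, Set.mem_ofPred_eq]
      refine and_congr_right fun hx => ⟨?_, ?_⟩
      · rintro ⟨y, hy, hz⟩
        obtain ⟨i, rfl⟩ := h.cover.exists_eq (hXG hx) (hSR x y hy)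
        exact ⟨i, hy, hz⟩
      · rintro ⟨i, hy, hz⟩
        exact ⟨g i x, hy, hz⟩
    rw [this]
    refine (measurable_fst hXm).inter (MeasurableSet.iUnion fun i => MeasurableSet.inter ?_ ?_)
    · exact (measurable_fst.prodMk ((g i).measurable.comp measurable_fst)) hS
    · exact (((g i).measurable.comp measurable_fst).prodMk measurable_snd)
        (h.family.measurableSet_graph n)
  have step2 : Cs * ν Y ≤ ∫⁻ x, ∑' z, E.indicator 1 (x, z) ∂ν := by
    refine (h.nonshrinking Y hYm (fun _ => n) measurable_const ⟨n, fun _ _ => le_rfl⟩).trans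
      ((measure_mono ?_).trans (h.cover.measure_exists_le hEm ?_))
    · intro z hz
      simp only [Set.mem_iUnion] at hz
      obtain ⟨y, ⟨-, x, -, hx, hxy⟩, hz⟩ := hz
      exact ⟨x, hx, y, hxy, hz⟩
    · rintro p ⟨-, y, hy, hz⟩
      exact R.iseqv.trans (hSR _ _ hy) (h.family.subset_rel n y _ hz)
  have step3 : ∀ x, 2 * ∑' z, E.indicator 1 (x, z) ≤
      Cs * X.indicator (fun x => ((S x).card : ℝ≥0∞)) x := by
    intro x
    by_cases hx : x ∈ X
    · obtain ⟨y₀, hy₀, hmin⟩ := Finset.exists_min_image (S x) (fun y => (F n y).card) (hXn x hx)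
      have hy₀G : y₀ ∈ G := h.cover.mem_of_rel (hSR x y₀ hy₀) (hXG hx)
      have h1 : ∑' z, E.indicator 1 (x, z) ≤ Cd * (F n y₀).card := by
        refine le_trans (ENNReal.tsum_le_tsum fun z => ?_) (h.doubling y₀ hy₀G n)
        by_cases hz : (x, z) ∈ E
        · obtain ⟨-, y, hy, hzy⟩ := hz
          rw [Set.indicator_of_mem (s := touchingUnion F n y₀)]
          · exact Set.indicator_le_self' (fun _ _ => zero_le) _
          · exact ⟨n, le_rfl, y, ⟨x, hSF x y hy, hSF x y₀ hy₀⟩, hzy⟩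
        · rw [Set.indicator_of_notMem hz]; exact zero_le
      have hcard0 : ((F n y₀).card : ℝ≥0∞) ≠ 0 := by
        simpa using (h.nonempty y₀ hy₀G n).ne_empty
      have hcard1 : ((F n y₀).card : ℝ≥0∞) ≠ ∞ := ENNReal.natCast_ne_top _
      have h2 : 2 * Cd / Cs ≤ (S x).card * ((F n y₀).card : ℝ≥0∞)⁻¹ := by
        refine hx.1.2.le.trans ?_
        rw [← nsmul_eq_mul]
        refine Finset.sum_le_card_nsmul _ _ _ fun y hy => ?_
        exact ENNReal.inv_le_inv.2 (by exact_mod_cast hmin y hy)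
      rw [← div_eq_mul_inv, ENNReal.le_div_iff_mul_le (Or.inl hcard0) (Or.inl hcard1)] at h2
      rw [Set.indicator_of_mem hx]
      calc 2 * ∑' z, E.indicator 1 (x, z) ≤ 2 * (Cd * (F n y₀).card) := by gcongr
        _ = Cs * (2 * Cd / Cs * (F n y₀).card) := by
            rw [← mul_assoc Cs, ENNReal.mul_div_cancel hCs hCs']; ring
        _ ≤ _ := by gcongr
    · have : ∀ z, E.indicator (1 : B × B → ℝ≥0∞) (x, z) = 0 := fun z =>
        Set.indicator_of_notMem (fun hm => hx hm.1) _
      simp [this]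
  have step4 : 2 * (Cs * J) ≤ Cs * J := by
    calc 2 * (Cs * J) ≤ 2 * ∫⁻ x, ∑' z, E.indicator 1 (x, z) ∂ν := by
          gcongr; exact le_trans (by gcongr) step2
      _ ≤ ∫⁻ x, 2 * ∑' z, E.indicator 1 (x, z) ∂ν := lintegral_const_mul_le _ _
      _ ≤ ∫⁻ x, Cs * X.indicator (fun x => ((S x).card : ℝ≥0∞)) x ∂ν := lintegral_mono step3
      _ = Cs * J := lintegral_const_mul' _ _ hCs'
  have hJtop : J ≠ ∞ := by
    refine ne_top_of_le_ne_top (b := I * ν Set.univ)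
      (ENNReal.mul_ne_top (ENNReal.natCast_ne_top _) (measure_ne_top _ _)) ?_
    rw [← lintegral_const]
    refine lintegral_mono fun x => le_trans (Set.indicator_le_self' (fun _ _ => zero_le) x) ?_
    exact_mod_cast hI x
  have hCJ : Cs * J = 0 := by
    by_contra hne
    have hfin : Cs * J ≠ ∞ := ENNReal.mul_ne_top hCs' hJtop
    have : Cs * J < 2 * (Cs * J) := by
      rw [two_mul]; exact ENNReal.lt_add_right hfin hne
    exact absurd step4 (not_le.2 this)
  have hJ0 : J = 0 := (mul_eq_zero.1 hCJ).resolve_left hCs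
  refine le_antisymm ?_ zero_le
  rw [← hJ0, ← lintegral_indicator_one hXm]
  refine lintegral_mono fun x => ?_
  by_cases hx : x ∈ X
  · rw [Set.indicator_of_mem hx, Set.indicator_of_mem hx]
    change (1 : ℝ≥0∞) ≤ (S x).card
    exact_mod_cast (hXn x hx).card_pos
  · simp [hx]

/-- The bounded choices `S I`, taken among the first `I` enumerated points, exhaust all `y` with `x
∈ F n y`; every finite partial sum is dominated by one of them. -/
theorem ae_tsum_inv_card_le [StandardBorelSpace B] [IsFiniteMeasure ν]
    (h : IsRegularFamily R ν g G F Cs Cd) (hCs : Cs ≠ 0) (hCs' : Cs ≠ ∞) (n : ℕ) :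
    ∀ᵐ x ∂ν, ∑' y, {y | x ∈ F n y}.indicator (fun y => ((F n y).card : ℝ≥0∞)⁻¹) y ≤
      2 * Cd / Cs := by
  classical
  let S : ℕ → B → Finset B := fun I x =>
    ((Finset.range I).image fun i => g i x).filter fun y => x ∈ F n y
  have hSm : ∀ I, MeasurableSet {p : B × B | p.2 ∈ S I p.1} := by
    intro I
    have : {p : B × B | p.2 ∈ S I p.1} =
        (⋃ i ∈ Finset.range I, {p : B × B | g i p.1 = p.2}) ∩
          {p : B × B | p.1 ∈ F n p.2} := by
      ext p; simp [S]
    rw [this]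
    refine (Finset.measurableSet_biUnion _ fun i _ => ?_).inter
      (measurable_swap (h.family.measurableSet_graph n))
    exact measurableSet_eq_fun ((g i).measurable.comp measurable_fst) measurable_snd
  have hnull : ∀ᵐ x ∂ν, ∀ I, x ∉ {x | x ∈ G ∧
      2 * Cd / Cs < ∑ y ∈ S I x, ((F n y).card : ℝ≥0∞)⁻¹} := by
    refine ae_all_iff.2 fun I => measure_eq_zero_iff_ae_notMem.1 ?_
    refine h.measure_sum_inv_card_gt_eq_zero hCs hCs' n (hSm I)
      (fun x y hy => (Finset.mem_filter.1 hy).2) (I := I) fun x => ?_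
    exact (Finset.card_filter_le _ _).trans (Finset.card_image_le.trans (by simp))
  filter_upwards [hnull, h.cover.ae_mem] with x hx hxG
  rw [ENNReal.tsum_eq_iSup_sum]
  refine iSup_le fun s => ?_
  have hex : ∀ y, ∃ i, x ∈ F n y → g i x = y := by
    intro y
    by_cases hy : x ∈ F n y
    · obtain ⟨i, hi⟩ := h.cover.exists_eq hxG (R.iseqv.symm (h.family.subset_rel n y x hy))
      exact ⟨i, fun _ => hi⟩
    · exact ⟨0, fun h => absurd h hy⟩
  choose i hi using hex
  have hle : ∑ y ∈ S (s.sup i + 1) x, ((F n y).card : ℝ≥0∞)⁻¹ ≤ 2 * Cd / Cs := by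
    by_contra hcon
    exact hx _ ⟨hxG, not_le.1 hcon⟩
  refine le_trans ?_ hle
  simp only [Set.indicator_apply, Set.mem_ofPred_eq]
  rw [← Finset.sum_filter]
  refine Finset.sum_le_sum_of_subset fun y hy => ?_
  obtain ⟨hys, hxy⟩ := Finset.mem_filter.1 hy
  refine Finset.mem_filter.2 ⟨Finset.mem_image.2 ⟨i y, ?_, hi y hxy⟩, hxy⟩
  exact Finset.mem_range.2 (Nat.lt_succ_of_le (Finset.le_sup hys))

/-- The averaging operators are bounded on `L¹`, uniformly in `n`. -/
theorem lintegral_average_le [StandardBorelSpace B] [IsFiniteMeasure ν]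
    (h : IsRegularFamily R ν g G F Cs Cd) (hCs : Cs ≠ 0) (hCs' : Cs ≠ ∞) (n : ℕ)
    {u : B → ℝ≥0∞} (hu : Measurable u) :
    ∫⁻ b, ((F n b).card : ℝ≥0∞)⁻¹ * ∑ x ∈ F n b, u x ∂ν ≤ 2 * Cd / Cs * ∫⁻ b, u b ∂ν := by
  have hv := (h.cover.measurable_sum_finset (h.family.measurableSet_graph n)
      (h.family.subset_rel n) (u := fun _ => 1) measurable_const).inv
  set v : B → ℝ≥0∞ := (G.indicator (fun b => ∑ x ∈ F n b, (1 : ℝ≥0∞)))⁻¹ with hvdef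
  have hvG : ∀ b ∈ G, v b = ((F n b).card : ℝ≥0∞)⁻¹ := by
    intro b hb
    rw [hvdef, Pi.inv_apply, Set.indicator_of_mem hb]
    simp
  set k : B → B → ℝ≥0∞ := fun b x =>
    {p : B × B | p.2 ∈ F n p.1}.indicator (fun p => v p.1 * u p.2) (b, x) with hk
  have hkm : Measurable (Function.uncurry k) :=
    ((hv.comp measurable_fst).mul (hu.comp measurable_snd)).indicator
      (h.family.measurableSet_graph n)
  calc ∫⁻ b, ((F n b).card : ℝ≥0∞)⁻¹ * ∑ x ∈ F n b, u x ∂ν = ∫⁻ b, ∑' x, k b x ∂ν := by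
        refine lintegral_congr_ae ?_
        filter_upwards [h.cover.ae_mem] with b hb
        rw [← hvG b hb, Finset.mul_sum, ← tsum_indicator_finset]
        rfl
    _ = ∫⁻ x, ∑' b, k b x ∂ν := h.cover.lintegral_tsum_comm hkm (fun b b' hb => by
        have hm : (b, b') ∉ {p : B × B | p.2 ∈ F n p.1} := fun hm =>
          hb (h.family.subset_rel n _ _ hm)
        exact Set.indicator_of_notMem hm _)
    -- After transport, `u x` carries the weight `∑ 1/|F n b|` over all `b` with `x ∈ F n b`.
    _ ≤ ∫⁻ x, 2 * Cd / Cs * u x ∂ν := by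
        refine lintegral_mono_ae ?_
        filter_upwards [h.cover.ae_mem, h.ae_tsum_inv_card_le hCs hCs' n] with x hx hxle
        have : ∀ b, k b x =
            {y | x ∈ F n y}.indicator (fun y => ((F n y).card : ℝ≥0∞)⁻¹) b * u x := by
          intro b
          by_cases hb : x ∈ F n b
          · have hbG := h.cover.mem_of_rel (R.iseqv.symm (h.family.subset_rel n b x hb)) hx
            simp [hk, Set.indicator, hb, hvG b hbG]
          · simp [hk, Set.indicator, hb]
        rw [tsum_congr this, ENNReal.tsum_mul_right]
        gcongr
    _ = _ := lintegral_const_mul _ hu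

end IsRegularFamily

/-! ### Algebra and measurability of averages -/

section average

variable {𝕜 α : Type*} [RCLike 𝕜] {F : ℕ → α → Finset α}

theorem average_add (f f' : α → 𝕜) (n : ℕ) (b : α) :
    average F (f + f') n b = average F f n b + average F f' n b := by
  simp [average, Finset.sum_add_distrib, mul_add]

theorem average_sub (f f' : α → 𝕜) (n : ℕ) (b : α) :
    average F (f - f') n b = average F f n b - average F f' n b := by
  simp [average, Finset.sum_sub_distrib, mul_sub]

theorem average_smul (c : 𝕜) (f : α → 𝕜) (n : ℕ) (b : α) :
    average F (c • f) n b = c * average F f n b := by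
  simp only [average, Pi.smul_apply, smul_eq_mul, ← Finset.mul_sum]
  ring

theorem average_congr {f f' : α → 𝕜} {n : ℕ} {b : α} (h : ∀ x ∈ F n b, f x = f' x) :
    average F f n b = average F f' n b := by
  rw [average, average, Finset.sum_congr rfl h]

theorem enorm_average_le (f : α → 𝕜) (n : ℕ) (b : α) :
    ‖average F f n b‖ₑ ≤ ((F n b).card : ℝ≥0∞)⁻¹ * ∑ x ∈ F n b, ‖f x‖ₑ := by
  by_cases h0 : (F n b).card = 0
  · simp [average, h0]
  · have h1 : ((F n b).card : 𝕜) ≠ 0 := Nat.cast_ne_zero.2 h0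
    have h2 : ‖((F n b).card : 𝕜)‖ₑ = (F n b).card := by
      rw [← ofReal_norm, RCLike.norm_natCast, ENNReal.ofReal_natCast]
    rw [average, enorm_mul, enorm_inv h1, h2]
    gcongr
    exact enorm_sum_le _ _

end average

theorem le_div_mul_of_mul_le {a b c d : ℝ≥0∞} (h0 : b ≠ 0) (ht : b ≠ ∞) (h : b * a ≤ c * d) :
    a ≤ c / b * d := by
  rw [ENNReal.div_eq_inv_mul, mul_assoc]
  calc a = b⁻¹ * (b * a) := by rw [← mul_assoc, ENNReal.inv_mul_cancel h0 ht, one_mul]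
    _ ≤ _ := by gcongr

namespace IsOrbitCover

variable {R : Setoid B} {ν : Measure B} {g : ℕ → B ≃ᵐ B} {G : Set B}

/-- On `G` the finite sum is the limit of eventually constant partial sums along the first-hit
enumeration. -/
theorem aestronglyMeasurable_sum_finset [StandardBorelSpace B] {E : Type*} [NormedAddCommGroup E]
    (h : IsOrbitCover R ν g G) {T : B → Finset B} (hT : MeasurableSet {p : B × B | p.2 ∈ T p.1})
    (hTR : ∀ b, ∀ x ∈ T b, R.r b x) {f : B → E} (hf : StronglyMeasurable f) :
    AEStronglyMeasurable (fun b => ∑ x ∈ T b, f x) ν := by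
  classical
  set A : ℕ → Set B := fun i => firstHit g i ∩ {b | g i b ∈ T b} with hA
  have hAm : ∀ i, MeasurableSet (A i) := fun i => (measurableSet_firstHit g i).inter
    ((measurable_id.prodMk (g i).measurable) hT)
  refine aestronglyMeasurable_of_tendsto_ae atTop
    (f := fun N b => ∑ i ∈ Finset.range N, (A i).indicator (fun b => f (g i b)) b) (fun N => ?_) ?_
  · refine (Finset.stronglyMeasurable_fun_sum _ fun i _ => ?_).aestronglyMeasurable
    exact (hf.comp_measurable (g i).measurable).indicator (hAm i)
  · filter_upwards [h.ae_mem] with b hb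
    have hex : ∀ x, ∃ i, x ∈ T b → b ∈ firstHit g i ∧ g i b = x := by
      intro x
      by_cases hx : x ∈ T b
      · obtain ⟨i, hi⟩ := h.exists_firstHit hb (hTR b x hx)
        exact ⟨i, fun _ => hi⟩
      · exact ⟨0, fun h => absurd h hx⟩
    choose i hi using hex
    have hsum : ∑ j ∈ (T b).image i, (A j).indicator (fun b => f (g j b)) b = ∑ x ∈ T b, f x := by
      rw [Finset.sum_image]
      · refine Finset.sum_congr rfl fun x hx => ?_
        have hmem : b ∈ A (i x) := ⟨(hi x hx).1, by
          change g (i x) b ∈ T b; rw [(hi x hx).2]; exact hx⟩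
        rw [Set.indicator_of_mem hmem, (hi x hx).2]
      · intro x hx y hy hxy
        rw [← (hi x hx).2, ← (hi y hy).2, hxy]
    rw [← hsum]
    refine (hasSum_sum_of_ne_finset_zero fun j hj => ?_).tendsto_sum_nat
    refine Set.indicator_of_notMem (fun hjA => hj ?_) _
    refine Finset.mem_image.2 ⟨g j b, hjA.2, ?_⟩
    exact firstHit_unique (hi _ hjA.2).1 hjA.1 (hi _ hjA.2).2

end IsOrbitCover

/-! ### Stability of convergence under L¹ limits -/

/-- The averages of `f` converge to its conditional expectation, almost everywhere and in `L¹`. -/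
structure AverageConverges {𝕜 : Type*} [RCLike 𝕜] (R : Setoid B) (ν : Measure B)
    (F : ℕ → B → Finset B) (f : B → 𝕜) : Prop where
  ae_tendsto : ∀ᵐ b ∂ν, Tendsto (fun n => average F f n b) atTop
    (𝓝 ((ν[f | invariantSigma R]) b))
  eLpNorm_tendsto : Tendsto (fun n => eLpNorm
    (fun b => average F f n b - (ν[f | invariantSigma R]) b) 1 ν) atTop (𝓝 0)

namespace IsRegularFamily

variable {R : Setoid B} {ν : Measure B} {g : ℕ → B ≃ᵐ B} {G : Set B} {F : ℕ → B → Finset B}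
  {Cs Cd : ℝ≥0∞} {𝕜 : Type*} [RCLike 𝕜]

theorem ae_average_congr (h : IsRegularFamily R ν g G F Cs Cd) {f f' : B → 𝕜} (hff : f =ᵐ[ν] f') :
    ∀ᵐ b ∂ν, ∀ n, average F f n b = average F f' n b := by
  filter_upwards [h.cover.ae_forall_rel hff] with b hb n
  exact average_congr fun x hx => hb x (h.family.subset_rel n b x hx)

theorem aestronglyMeasurable_average [StandardBorelSpace B] (h : IsRegularFamily R ν g G F Cs Cd)
    {f : B → 𝕜} (hf : AEStronglyMeasurable f ν) (n : ℕ) :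
    AEStronglyMeasurable (average F f n) ν := by
  have h1 : AEStronglyMeasurable (average F (hf.mk f) n) ν := by
    refine AEStronglyMeasurable.mul ?_ (h.cover.aestronglyMeasurable_sum_finset
      (h.family.measurableSet_graph n) (h.family.subset_rel n) hf.stronglyMeasurable_mk)
    have := h.cover.aestronglyMeasurable_sum_finset (h.family.measurableSet_graph n)
      (h.family.subset_rel n) (f := fun _ => (1 : 𝕜)) stronglyMeasurable_const
    simp only [Finset.sum_const, nsmul_eq_mul, mul_one] at this
    exact (this.aemeasurable.inv).aestronglyMeasurable
  refine h1.congr ?_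
  filter_upwards [h.ae_average_congr hf.ae_eq_mk] with b hb
  exact (hb n).symm

theorem eLpNorm_average_le [StandardBorelSpace B] [IsFiniteMeasure ν]
    (h : IsRegularFamily R ν g G F Cs Cd) (hCs : Cs ≠ 0) (hCs' : Cs ≠ ∞)
    {f : B → 𝕜} (hf : AEStronglyMeasurable f ν) (n : ℕ) :
    eLpNorm (average F f n) 1 ν ≤ 2 * Cd / Cs * eLpNorm f 1 ν := by
  rw [eLpNorm_congr_ae hf.ae_eq_mk, eLpNorm_one_eq_lintegral_enorm,
    eLpNorm_one_eq_lintegral_enorm]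
  refine le_trans (lintegral_mono_ae ?_)
    (h.lintegral_average_le hCs hCs' n hf.stronglyMeasurable_mk.enorm)
  filter_upwards [h.ae_average_congr hf.ae_eq_mk] with b hb
  rw [hb n]
  exact enorm_average_le _ _ _

theorem integrable_average [StandardBorelSpace B] [IsFiniteMeasure ν]
    (h : IsRegularFamily R ν g G F Cs Cd) (hCs : Cs ≠ 0) (hCs' : Cs ≠ ∞) (hCd : Cd ≠ ∞)
    {f : B → 𝕜} (hf : Integrable f ν) (n : ℕ) : Integrable (average F f n) ν := by
  rw [← memLp_one_iff_integrable] at hf ⊢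
  refine ⟨h.aestronglyMeasurable_average hf.1 n,
    (h.eLpNorm_average_le hCs hCs' hf.1 n).trans_lt ?_⟩
  exact ENNReal.mul_lt_top (ENNReal.div_lt_top (ENNReal.mul_ne_top (by simp) hCd) hCs) hf.2

theorem averageConverges_congr [IsFiniteMeasure ν] (h : IsRegularFamily R ν g G F Cs Cd)
    {f f' : B → 𝕜} (hff : f =ᵐ[ν] f') (hf : AverageConverges R ν F f) :
    AverageConverges R ν F f' := by
  have h1 := h.ae_average_congr hff
  have h2 : ν[f | invariantSigma R] =ᵐ[ν] ν[f' | invariantSigma R] := condExp_congr_ae hff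
  constructor
  · filter_upwards [h1, h2, hf.ae_tendsto] with b hb1 hb2 hb3
    rw [← hb2]
    exact hb3.congr hb1
  · refine hf.eLpNorm_tendsto.congr fun n => eLpNorm_congr_ae ?_
    filter_upwards [h1, h2] with b hb1 hb2
    rw [hb1 n, hb2]

/-- The maximal inequality for the averages of an integrable function. -/
theorem measure_exists_enorm_average_ge_le [StandardBorelSpace B]
    (h : IsRegularFamily R ν g G F Cs Cd) {f : B → 𝕜} (hf : AEStronglyMeasurable f ν) (c : ℝ≥0∞) :
    c * (Cs * ν {b | ∃ n, c ≤ ‖average F f n b‖ₑ}) ≤ Cd * eLpNorm f 1 ν := by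
  rw [eLpNorm_congr_ae hf.ae_eq_mk, eLpNorm_one_eq_lintegral_enorm]
  refine le_trans ?_ (h.maximal_inequality hf.stronglyMeasurable_mk.enorm c)
  gcongr c * (Cs * ?_)
  refine measure_mono_ae ?_
  filter_upwards [h.cover.ae_mem, h.ae_average_congr hf.ae_eq_mk] with b hb hbc hbn
  obtain ⟨n, hn⟩ := hbn
  refine ⟨hb, n, ?_⟩
  rw [hbc n] at hn
  have hcard0 : ((F n b).card : ℝ≥0∞) ≠ 0 := by simpa using (h.nonempty b hb n).ne_empty
  have := hn.trans (enorm_average_le (F := F) (hf.mk f) n b)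
  rwa [mul_comm, ← div_eq_mul_inv,
    ENNReal.le_div_iff_mul_le (Or.inl hcard0) (Or.inl (ENNReal.natCast_ne_top _))] at this

/-- The functions whose averages converge form a closed set in `L¹`. -/
theorem averageConverges_of_approx [StandardBorelSpace B] [IsProbabilityMeasure ν]
    (h : IsRegularFamily R ν g G F Cs Cd) (hCs : Cs ≠ 0) (hCs' : Cs ≠ ∞) (hCd : Cd ≠ ∞)
    {f : B → 𝕜} (hf : Integrable f ν)
    (happ : ∀ ε : ℝ≥0∞, ε ≠ 0 → ∃ f' : B → 𝕜, Integrable f' ν ∧ AverageConverges R ν F f' ∧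
      eLpNorm (f - f') 1 ν ≤ ε) : AverageConverges R ν F f := by
  have hsplit : ∀ f' : B → 𝕜, Integrable f' ν → ∀ᵐ b ∂ν, ∀ n,
      average F f n b - (ν[f | invariantSigma R]) b = average F (f - f') n b +
        (average F f' n b - (ν[f' | invariantSigma R]) b) -
        (ν[f - f' | invariantSigma R]) b := by
    intro f' hf'
    filter_upwards [condExp_sub hf hf' (invariantSigma R)] with b hb n
    rw [hb, average_sub, Pi.sub_apply]
    ring
  set C := 2 * Cd / Cs with hC
  have hCtop : C ≠ ∞ := (ENNReal.div_lt_top (ENNReal.mul_ne_top (by simp) hCd) hCs).ne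
  constructor
  -- The error splits into the average of `f - f'`, the error for `f'` and the conditional
  -- expectation of `f - f'`; each is made smaller than `δ`, whence the 3. The first is controlled
  -- by the maximal inequality, the third by Markov and L¹ contractivity.
  · have key : ∀ k : ℕ, ∀ᵐ b ∂ν, ∀ᶠ n in atTop,
        ‖average F f n b - (ν[f | invariantSigma R]) b‖ < 3 * (1 / ((k : ℝ) + 1)) := by
      intro k
      set δ : ℝ := 1 / ((k : ℝ) + 1) with hδ
      have hδpos : 0 < δ := by positivity
      set c : ℝ≥0∞ := ENNReal.ofReal δ with hc
      have hc0 : c ≠ 0 := (ENNReal.ofReal_pos.2 hδpos).ne'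
      have hctop : c ≠ ∞ := ENNReal.ofReal_ne_top
      have hlt : ∀ z : 𝕜, ¬ c ≤ ‖z‖ₑ → ‖z‖ < δ := by
        intro z hz
        rw [not_le, ← ofReal_norm, hc] at hz
        exact (ENNReal.ofReal_lt_ofReal_iff hδpos).1 hz
      rw [ae_iff]
      set bad := {b | ¬ ∀ᶠ n in atTop,
        ‖average F f n b - (ν[f | invariantSigma R]) b‖ < 3 * δ} with hbad
      have hle : ∀ ε : ℝ≥0∞, ε ≠ 0 → ν bad ≤ (Cd / (c * Cs) + 1 / c) * ε := by
        intro ε hε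
        obtain ⟨f', hf', hconv, hdist⟩ := happ ε hε
        have hd : Integrable (f - f') ν := hf.sub hf'
        have m1 : ν {b | ∃ n, c ≤ ‖average F (f - f') n b‖ₑ} ≤ Cd / (c * Cs) * ε := by
          have := (h.measure_exists_enorm_average_ge_le hd.1 c).trans
            (mul_le_mul_right hdist Cd)
          exact le_div_mul_of_mul_le (mul_ne_zero hc0 hCs) (ENNReal.mul_ne_top hctop hCs')
            (by rwa [mul_assoc])
        have m2 : ν {b | c ≤ ‖(ν[f - f' | invariantSigma R]) b‖ₑ} ≤ 1 / c * ε := by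
          have h1 := mul_meas_ge_le_lintegral₀ (μ := ν)
            (f := fun b => ‖(ν[f - f' | invariantSigma R]) b‖ₑ)
            (integrable_condExp.1.enorm) c
          rw [← eLpNorm_one_eq_lintegral_enorm] at h1
          have h2 := (h1.trans (eLpNorm_condExp_le_eLpNorm (f - f') le_rfl)).trans hdist
          exact le_div_mul_of_mul_le hc0 hctop (by rwa [one_mul])
        rw [add_mul]
        refine le_trans (le_trans (measure_mono_ae ?_) (measure_union_le _ _)) (add_le_add m1 m2)
        filter_upwards [hsplit f' hf', hconv.ae_tendsto] with b hb hb'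
        intro hbb
        by_contra hcon
        obtain ⟨hc1, hc2⟩ := not_or.1 hcon
        refine hbb ?_
        have hev := (Metric.tendsto_nhds.1 hb') δ hδpos
        filter_upwards [hev] with n hn
        rw [dist_eq_norm] at hn
        have e1 := hlt _ fun hle => hc1 ⟨n, hle⟩
        have e2 := hlt _ hc2
        rw [hb n]
        calc _ ≤ ‖average F (f - f') n b + (average F f' n b - (ν[f' | invariantSigma R]) b)‖ +
              ‖(ν[f - f' | invariantSigma R]) b‖ := norm_sub_le _ _
          _ ≤ ‖average F (f - f') n b‖ + ‖average F f' n b - (ν[f' | invariantSigma R]) b‖ +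
              ‖(ν[f - f' | invariantSigma R]) b‖ := by gcongr; exact norm_add_le _ _
          _ < 3 * δ := by linarith
      have hKtop : Cd / (c * Cs) + 1 / c ≠ ∞ := ENNReal.add_ne_top.2
        ⟨(ENNReal.div_lt_top hCd (mul_ne_zero hc0 hCs)).ne,
          (ENNReal.div_lt_top ENNReal.one_ne_top hc0).ne⟩
      by_contra hne
      obtain ⟨ε, hε, hε'⟩ := ENNReal.exists_pos_mul_lt hKtop hne
      exact absurd (hle ε hε.ne') (not_le.2 (by rwa [mul_comm]))
    filter_upwards [ae_all_iff.2 key] with b hb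
    rw [Metric.tendsto_nhds]
    intro ε hε
    obtain ⟨k, hk⟩ := exists_nat_one_div_lt (show (0 : ℝ) < ε / 3 by positivity)
    filter_upwards [hb k] with n hn
    rw [dist_eq_norm]
    linarith
  · rw [ENNReal.tendsto_atTop_zero]
    intro ε hε
    -- The same three terms in norm: `C` bounds the averaging operators, the two units the remaining
    -- terms.
    obtain ⟨η, hη, hη'⟩ := ENNReal.exists_pos_mul_lt (a := C + 1 + 1) (by simp [hCtop]) hε.ne'
    obtain ⟨f', hf', hconv, hdist⟩ := happ η hη.ne'
    have hd : Integrable (f - f') ν := hf.sub hf'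
    obtain ⟨N, hN⟩ := ENNReal.tendsto_atTop_zero.1 hconv.eLpNorm_tendsto η hη
    refine ⟨N, fun n hn => ?_⟩
    have i1 := h.aestronglyMeasurable_average hd.1 n
    have i2 : AEStronglyMeasurable
        (fun b => average F f' n b - (ν[f' | invariantSigma R]) b) ν :=
      (h.aestronglyMeasurable_average hf'.1 n).sub integrable_condExp.1
    calc eLpNorm (fun b => average F f n b - (ν[f | invariantSigma R]) b) 1 ν
        = eLpNorm (average F (f - f') n +
          (fun b => average F f' n b - (ν[f' | invariantSigma R]) b) -
          ν[f - f' | invariantSigma R]) 1 ν := by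
          refine eLpNorm_congr_ae ?_
          filter_upwards [hsplit f' hf'] with b hb
          exact hb n
      _ ≤ eLpNorm (average F (f - f') n) 1 ν +
          eLpNorm (fun b => average F f' n b - (ν[f' | invariantSigma R]) b) 1 ν +
          eLpNorm (ν[f - f' | invariantSigma R]) 1 ν :=
          (eLpNorm_sub_le (i1.add i2) integrable_condExp.1 le_rfl).trans
            (by gcongr; exact eLpNorm_add_le i1 i2 le_rfl)
      _ ≤ C * η + η + η := by
          gcongr
          · exact (h.eLpNorm_average_le hCs hCs' hd.1 n).trans (by gcongr)
          · exact hN n hn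
          · exact (eLpNorm_condExp_le_eLpNorm _ le_rfl).trans hdist
      _ = η * (C + 1 + 1) := by ring
      _ ≤ ε := hη'.le

end IsRegularFamily

/-! ### From the hypotheses to a regular family -/

theorem exists_isRegularFamily [StandardBorelSpace B] {R : Setoid B} {ν : Measure B}
    {g : ℕ → B ≃ᵐ B} {G : Set B} (h : IsOrbitCover R ν g G) {F : ℕ → B → Finset B}
    (hF : IsBorelFamily R F) (hshr : IsNonShrinking ν F) (hdbl : IsDoubling ν F) :
    ∃ (G' : Set B) (Cs Cd : ℝ≥0∞), Cs ≠ 0 ∧ Cs ≠ ∞ ∧ Cd ≠ ∞ ∧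
      IsRegularFamily R ν g G' F Cs Cd := by
  obtain ⟨C, hC, hshr⟩ := hshr
  obtain ⟨D, hD, hdbl⟩ := hdbl
  have hC0 : ENNReal.ofReal C ≠ 0 := (ENNReal.ofReal_pos.2 hC).ne'
  have hshr' : ∀ Y : Set B, MeasurableSet Y → ∀ ρ : B → ℕ, Measurable ρ →
      (∃ N, ∀ y ∈ Y, ρ y ≤ N) →
      ENNReal.ofReal C * ν Y ≤ ν (⋃ y ∈ Y, (F (ρ y) y : Set B)) := by
    rintro Y hY ρ hρ ⟨N, hN⟩
    have := hshr Y hY (fun y => ρ y) (hρ.comp measurable_subtype_coe) ⟨N, fun y => hN y y.2⟩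
    rwa [Set.biUnion_eq_iUnion]
  have hne : ∀ᵐ b ∂ν, ∀ n, (F n b).Nonempty := by
    refine ae_all_iff.2 fun n => ?_
    -- The points of `G` with empty `F n b`: the union of their sets is empty, so non-shrinking
    -- makes `Y` null.
    set Y := {b | b ∈ G ∧ ∀ x, R.r b x → (b, x) ∈ {p : B × B | p.2 ∈ F n p.1}ᶜ} with hY
    have hYm : MeasurableSet Y := h.measurableSet_forall_rel (hF.measurableSet_graph n).compl
    have hYF : ∀ y ∈ Y, ∀ x, x ∉ F n y := fun y hy x hx => hy.2 x (hF.subset_rel n y x hx) hx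
    have h0 := hshr' Y hYm (fun _ => n) measurable_const ⟨n, fun _ _ => le_rfl⟩
    have hempty : (⋃ y ∈ Y, (F n y : Set B)) = ∅ := by
      refine Set.eq_empty_of_forall_notMem fun x hx => ?_
      simp only [Set.mem_iUnion] at hx
      obtain ⟨y, hy, hx⟩ := hx
      exact hYF y hy x hx
    rw [hempty, measure_empty] at h0
    have hY0 : ν Y = 0 := (mul_eq_zero.1 (le_antisymm h0 zero_le)).resolve_left hC0
    filter_upwards [h.ae_mem, measure_eq_zero_iff_ae_notMem.1 hY0] with b hb hbY
    by_contra hcon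
    rw [Finset.not_nonempty_iff_eq_empty] at hcon
    refine hbY ⟨hb, fun x _ hx => ?_⟩
    have hx' : x ∈ F n b := hx
    simp [hcon] at hx'
  obtain ⟨G', hG', -, hp⟩ := h.exists_restrict (hne.and hdbl)
  refine ⟨G', ENNReal.ofReal C, ENNReal.ofReal D, hC0, ENNReal.ofReal_ne_top,
    ENNReal.ofReal_ne_top, hG', hF, fun b hb => (hp b hb).1, fun b hb n => ?_, hshr'⟩
  obtain ⟨hfin, hle⟩ := (hp b hb).2 n
  have hcoe : touchingUnion F n b = (hfin.toFinset : Set B) := hfin.coe_toFinset.symm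
  rw [hcoe, tsum_indicator_finset]
  rw [Set.ncard_eq_toFinset_card _ hfin] at hle
  have := ENNReal.ofReal_le_ofReal hle
  rw [ENNReal.ofReal_mul hD.le, ENNReal.ofReal_natCast, ENNReal.ofReal_natCast] at this
  simpa using this

/-! ### Invariant functions and coboundaries -/

/-- `φ` preserves `ν` and maps each invariant set onto itself, so both functions have equal
integrals over invariant sets. -/
theorem condExp_comp_eq {R : Setoid B} {ν : Measure B} [IsFiniteMeasure ν] {𝕜 : Type*} [RCLike 𝕜]
    {φ : Equiv.Perm B} (hφ : φ ∈ Inn R)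
    (hmp : MeasurePreserving φ ν ν) {q : B → 𝕜} (hq : Integrable q ν) :
    ν[q ∘ φ | invariantSigma R] =ᵐ[ν] ν[q | invariantSigma R] := by
  have hqφ : Integrable (q ∘ φ) ν := hmp.integrable_comp_of_integrable hq
  have hme : MeasurableEmbedding φ :=
    (MeasurableEquiv.mk φ hφ.1 hφ.2.1).measurableEmbedding
  refine (ae_eq_condExp_of_forall_setIntegral_eq (invariantSigma_le R) hqφ
    (fun s _ _ => integrable_condExp.integrableOn) (fun s hs _ => ?_)
    stronglyMeasurable_condExp.aestronglyMeasurable).symm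
  rw [setIntegral_condExp (invariantSigma_le R) hq hs]
  have hpre : φ ⁻¹' s = s := by
    ext b
    exact ⟨fun hb => hs.2 _ _ (R.iseqv.symm (hφ.2.2 b)) hb, fun hb => hs.2 _ _ (hφ.2.2 b) hb⟩
  have := hmp.setIntegral_preimage_emb hme q s
  rw [hpre] at this
  exact this.symm

/-- The sums of `q` over `F n b` and over its image cancel outside the symmetric difference. -/
theorem norm_average_sub_comp_le {α 𝕜 : Type*} [RCLike 𝕜] {F : ℕ → α → Finset α}
    (φ : Equiv.Perm α) {q : α → 𝕜} {C : ℝ} (hC : ∀ b, ‖q b‖ ≤ C)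
    (n : ℕ) (b : α) : ‖average F (q - q ∘ φ) n b‖ ≤
      C * (((symmDiff (F n b : Set α) (φ '' (F n b : Set α))).ncard : ℝ) / (F n b).card) := by
  classical
  set S := F n b with hS
  set S' := S.map φ.toEmbedding with hS'
  have hsum : ∑ x ∈ S, (q - q ∘ φ) x = ∑ x ∈ S, q x - ∑ x ∈ S', q x := by
    rw [hS', Finset.sum_map]
    simp [Finset.sum_sub_distrib]
  have hcoe : symmDiff (S : Set α) (φ '' (S : Set α)) = (symmDiff S S' : Finset α) := by
    rw [Finset.coe_symmDiff, hS', Finset.coe_map]; rfl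
  have hbound : ‖∑ x ∈ S, q x - ∑ x ∈ S', q x‖ ≤ C * ((symmDiff S S').card : ℝ) := by
    rw [← Finset.sum_sdiff_sub_sum_sdiff]
    have hcard : ((symmDiff S S').card : ℝ) = (S \ S').card + (S' \ S).card := by
      rw [← Nat.cast_add, ← Finset.card_union_of_disjoint]
      · rfl
      · exact disjoint_sdiff_sdiff
    have hle : ∀ t : Finset α, ‖∑ x ∈ t, q x‖ ≤ t.card * C := fun t =>
      (norm_sum_le_of_le t fun x _ => hC x).trans (by simp)
    calc _ ≤ ‖∑ x ∈ S \ S', q x‖ + ‖∑ x ∈ S' \ S, q x‖ := norm_sub_le _ _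
      _ ≤ (S \ S').card * C + (S' \ S).card * C := add_le_add (hle _) (hle _)
      _ = _ := by rw [hcard]; ring
  rw [hcoe, Set.ncard_coe_finset, average, hsum, norm_mul, norm_inv, RCLike.norm_natCast]
  rw [← hS, ← mul_div_assoc, inv_mul_eq_div]
  gcongr

namespace IsRegularFamily

variable {R : Setoid B} {ν : Measure B} {g : ℕ → B ≃ᵐ B} {G : Set B} {F : ℕ → B → Finset B}
  {Cs Cd : ℝ≥0∞} {𝕜 : Type*} [RCLike 𝕜]

theorem averageConverges_of_invariant [IsFiniteMeasure ν] (h : IsRegularFamily R ν g G F Cs Cd)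
    {f : B → 𝕜} (hf : StronglyMeasurable[invariantSigma R] f) (hfi : Integrable f ν) :
    AverageConverges R ν F f := by
  have hE : ν[f | invariantSigma R] = f :=
    condExp_of_stronglyMeasurable (invariantSigma_le R) hf hfi
  have hconst : ∀ b b', R.r b b' → f b' = f b := by
    intro b b' hr
    have hm : MeasurableSet[invariantSigma R] (f ⁻¹' {f b}) :=
      hf.measurable (measurableSet_singleton _)
    exact hm.2 b b' hr rfl
  have hA : ∀ᵐ b ∂ν, ∀ n, average F f n b = f b := by
    filter_upwards [h.cover.ae_mem] with b hb n
    have hcard : ((F n b).card : 𝕜) ≠ 0 := by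
      simpa using (h.nonempty b hb n).ne_empty
    rw [average, Finset.sum_congr rfl fun x hx => hconst b x (h.family.subset_rel n b x hx),
      Finset.sum_const, nsmul_eq_mul, inv_mul_cancel_left₀ hcard]
  constructor
  · filter_upwards [hA] with b hb
    simp only [hb, hE]
    exact tendsto_const_nhds
  · have : ∀ n, eLpNorm (fun b => average F f n b - (ν[f | invariantSigma R]) b) 1 ν = 0 := by
      intro n
      rw [hE, ← eLpNorm_zero (p := 1) (μ := ν) (ε := 𝕜)]
      refine eLpNorm_congr_ae ?_
      filter_upwards [hA] with b hb
      simp [hb n]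
    simp only [this]
    exact tendsto_const_nhds

/-- The Følner condition sends the averages to 0 almost everywhere, the conditional expectation
vanishes, and the uniform bound `C + C` gives L¹ convergence by domination. -/
theorem averageConverges_sub_comp [StandardBorelSpace B] [IsProbabilityMeasure ν]
    (h : IsRegularFamily R ν g G F Cs Cd) {φ : Equiv.Perm B} (hφ : φ ∈ Inn R)
    (hmp : MeasurePreserving φ ν ν)
    (hlim : ∀ᵐ b ∂ν, Tendsto
      (fun n => ((symmDiff (F n b : Set B) (φ '' (F n b : Set B))).ncard : ℝ) / (F n b).card)
      atTop (𝓝 0))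
    {q : B → 𝕜} (hq : StronglyMeasurable q) {C : ℝ} (hC : ∀ b, ‖q b‖ ≤ C) :
    AverageConverges R ν F (q - q ∘ φ) := by
  have hqi : Integrable q ν :=
    Integrable.of_bound hq.aestronglyMeasurable C (Eventually.of_forall hC)
  have hqφ : Integrable (q ∘ φ) ν := hmp.integrable_comp_of_integrable hqi
  have hE : ν[q - q ∘ φ | invariantSigma R] =ᵐ[ν] 0 := by
    filter_upwards [condExp_sub hqi hqφ (invariantSigma R), condExp_comp_eq hφ hmp hqi]
      with b h1 h2
    rw [h1, Pi.sub_apply, h2, sub_self]; rfl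
  have hA : ∀ᵐ b ∂ν, Tendsto (fun n => average F (q - q ∘ φ) n b) atTop (𝓝 0) := by
    filter_upwards [hlim] with b hb
    refine squeeze_zero_norm (fun n => norm_average_sub_comp_le φ hC n b) ?_
    simpa using hb.const_mul C
  have hbd : ∀ n b, ‖average F (q - q ∘ φ) n b‖ₑ ≤ ENNReal.ofReal (C + C) := by
    intro n b
    refine (enorm_average_le _ _ _).trans ?_
    have hle : ∀ x ∈ F n b, ‖(q - q ∘ φ) x‖ₑ ≤ ENNReal.ofReal (C + C) := by
      intro x _
      rw [← ofReal_norm]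
      exact ENNReal.ofReal_le_ofReal ((norm_sub_le _ _).trans (add_le_add (hC _) (hC _)))
    refine (mul_le_mul_right (Finset.sum_le_card_nsmul _ _ _ hle) _).trans ?_
    rw [nsmul_eq_mul, ← mul_assoc]
    exact mul_le_of_le_one_left zero_le (ENNReal.inv_mul_le_one _)
  constructor
  · filter_upwards [hA, hE] with b h1 h2
    rwa [h2]
  · have hnorm : ∀ n, eLpNorm
        (fun b => average F (q - q ∘ φ) n b - (ν[q - q ∘ φ | invariantSigma R]) b) 1 ν =
        ∫⁻ b, ‖average F (q - q ∘ φ) n b‖ₑ ∂ν := by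
      intro n
      rw [eLpNorm_one_eq_lintegral_enorm]
      refine lintegral_congr_ae ?_
      filter_upwards [hE] with b h2
      rw [h2, Pi.zero_apply, sub_zero]
    simp only [hnorm]
    have := tendsto_lintegral_of_dominated_convergence' (μ := ν)
      (F := fun n b => ‖average F (q - q ∘ φ) n b‖ₑ) (f := fun _ => 0)
      (fun _ => ENNReal.ofReal (C + C))
      (fun n => (h.aestronglyMeasurable_average (hqi.sub hqφ).1 n).enorm)
      (fun n => Eventually.of_forall (hbd n)) (by simp [ENNReal.ofReal_ne_top]) ?_
    · simpa using this
    · filter_upwards [hA] with b hb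
      simpa using hb.enorm

theorem averageConverges_add [StandardBorelSpace B] [IsFiniteMeasure ν]
    (h : IsRegularFamily R ν g G F Cs Cd) {f f' : B → 𝕜} (hfi : Integrable f ν)
    (hfi' : Integrable f' ν) (hf : AverageConverges R ν F f) (hf' : AverageConverges R ν F f') :
    AverageConverges R ν F (f + f') := by
  have hE := condExp_add hfi hfi' (invariantSigma R)
  constructor
  · filter_upwards [hE, hf.ae_tendsto, hf'.ae_tendsto] with b h1 h2 h3
    rw [h1]
    simp only [average_add]
    exact h2.add h3
  · have hsum := hf.eLpNorm_tendsto.add hf'.eLpNorm_tendsto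
    rw [add_zero] at hsum
    refine tendsto_of_tendsto_of_tendsto_of_le_of_le tendsto_const_nhds hsum
      (fun _ => zero_le) fun n => ?_
    have i1 : ∀ {u : B → 𝕜}, Integrable u ν → AEStronglyMeasurable
        (fun b => average F u n b - (ν[u | invariantSigma R]) b) ν := fun hu =>
      (h.aestronglyMeasurable_average hu.1 n).sub integrable_condExp.1
    refine le_trans (le_of_eq (eLpNorm_congr_ae ?_)) (eLpNorm_add_le (i1 hfi) (i1 hfi') le_rfl)
    filter_upwards [hE] with b hb
    simp only [hb, average_add, Pi.add_apply]
    ring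

theorem averageConverges_smul (c : 𝕜) {f : B → 𝕜} (hf : AverageConverges R ν F f) :
    AverageConverges R ν F (c • f) := by
  have hE := condExp_smul (μ := ν) c f (invariantSigma R)
  constructor
  · filter_upwards [hE, hf.ae_tendsto] with b h1 h2
    rw [h1]
    simp only [average_smul]
    exact h2.const_mul c
  · have hmul := ENNReal.Tendsto.const_mul (a := ‖c‖ₑ) hf.eLpNorm_tendsto (Or.inr enorm_ne_top)
    rw [mul_zero] at hmul
    refine hmul.congr fun n => ?_
    rw [← eLpNorm_const_smul]
    refine eLpNorm_congr_ae ?_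
    filter_upwards [hE] with b hb
    simp only [hb, average_smul, Pi.smul_apply, smul_eq_mul]
    ring

end IsRegularFamily

theorem ae_comp_eq_of_mem_closure {R : Setoid B} {ν : Measure B} {Φ : Set (Equiv.Perm B)}
    (hΦ : ∀ φ ∈ Φ, φ ∈ Inn R) (hmp : ∀ φ ∈ Inn R, MeasurePreserving φ ν ν) {E : Type*} {x : B → E}
    (hx : ∀ φ ∈ Φ, x ∘ φ =ᵐ[ν] x) {γ : Equiv.Perm B} (hγ : γ ∈ Subgroup.closure Φ) :
    x ∘ γ =ᵐ[ν] x := by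
  have hle : Subgroup.closure Φ ≤ Inn R := (Subgroup.closure_le _).2 hΦ
  induction hγ using Subgroup.closure_induction with
  | mem φ hφ => exact hx φ hφ
  | one => exact EventuallyEq.rfl
  | mul φ ψ hφ hψ h1 h2 =>
    have h3 := (hmp ψ (hle hψ)).quasiMeasurePreserving.ae_eq_comp h1
    exact h3.trans h2
  | inv φ hφ h1 =>
    have h3 := (hmp φ⁻¹ (hle (inv_mem hφ))).quasiMeasurePreserving.ae_eq_comp h1
    have h4 : (x ∘ φ) ∘ (φ⁻¹ : Equiv.Perm B) = x := by
      ext b; simp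
    rw [h4] at h3
    exact h3.symm

/-- A function that is almost everywhere invariant under an orbit cover agrees almost everywhere
with a function measurable for the σ-algebra of invariant sets. -/
theorem IsOrbitCover.exists_invariant_ae_eq [StandardBorelSpace B] {R : Setoid B} {ν : Measure B}
    {g : ℕ → B ≃ᵐ B} {G : Set B} (h : IsOrbitCover R ν g G) {𝕜 : Type*} [RCLike 𝕜] {x : B → 𝕜}
    (hx : AEStronglyMeasurable x ν) (hinv : ∀ i, x ∘ g i =ᵐ[ν] x) :
    ∃ w : B → 𝕜, StronglyMeasurable[invariantSigma R] w ∧ x =ᵐ[ν] w := by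
  set y := hx.mk x with hy
  have hym : Measurable y := hx.stronglyMeasurable_mk.measurable
  have hyinv : ∀ᵐ b ∂ν, ∀ i, y (g i b) = y b := by
    refine ae_all_iff.2 fun i => ?_
    filter_upwards [hinv i, hx.ae_eq_mk,
      (h.measurePreserving i).quasiMeasurePreserving.ae_eq_comp hx.ae_eq_mk] with b h1 h2 h3
    simp only [Function.comp_apply] at h1 h3
    rw [← hy] at h2 h3
    rw [← h3, h1, h2]
  -- The points whose class sees a single value of `y`. This set is invariant, so cutting `y` off
  -- outside it makes invariance exact.
  set G' := {b | b ∈ G ∧ ∀ b', R.r b b' → (b, b') ∈ {p : B × B | y p.2 = y p.1}} with hG'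
  have hG'm : MeasurableSet G' := h.measurableSet_forall_rel
    (measurableSet_eq_fun (hym.comp measurable_snd) (hym.comp measurable_fst))
  have hG'ae : ∀ᵐ b ∂ν, b ∈ G' := by
    filter_upwards [h.ae_mem, hyinv] with b hb hbi
    refine ⟨hb, fun b' hb' => ?_⟩
    obtain ⟨i, rfl⟩ := h.exists_eq hb hb'
    exact hbi i
  have hstep : ∀ b b', R.r b b' → b ∈ G' → b' ∈ G' ∧ y b' = y b := by
    intro b b' hr hb
    have hyb : ∀ c, R.r b c → y c = y b := hb.2
    exact ⟨⟨h.mem_of_rel hr hb.1, fun c hc =>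
      (hyb c (R.iseqv.trans hr hc)).trans (hyb b' hr).symm⟩, hyb b' hr⟩
  have hconst : ∀ b b', R.r b b' → G'.indicator y b' = G'.indicator y b := by
    intro b b' hr
    by_cases hb : b ∈ G'
    · obtain ⟨h1, h2⟩ := hstep b b' hr hb
      rw [Set.indicator_of_mem hb, Set.indicator_of_mem h1, h2]
    · have hb' : b' ∉ G' := fun hb' => hb (hstep b' b (R.iseqv.symm hr) hb').1
      rw [Set.indicator_of_notMem hb, Set.indicator_of_notMem hb']
  have hwm : Measurable[invariantSigma R] (G'.indicator y) := by
    intro t ht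
    refine ⟨(hym.indicator hG'm) ht, fun b b' hr hb => ?_⟩
    rw [Set.mem_preimage, hconst b b' hr]
    exact hb
  refine ⟨G'.indicator y, hwm.stronglyMeasurable, ?_⟩
  filter_upwards [hx.ae_eq_mk, hG'ae] with b h1 h2
  rw [Set.indicator_of_mem h2, h1]

/-! ### Convergence on all of L² -/

namespace IsRegularFamily

variable {R : Setoid B} {ν : Measure B} {g : ℕ → B ≃ᵐ B} {G : Set B} {F : ℕ → B → Finset B}
  {Cs Cd : ℝ≥0∞} {𝕜 : Type*} [RCLike 𝕜]

/-- The square integrable functions whose averages converge. -/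
def convergentSubmodule [StandardBorelSpace B] [IsProbabilityMeasure ν] (𝕜 : Type*) [RCLike 𝕜]
    (h : IsRegularFamily R ν g G F Cs Cd) : Submodule 𝕜 (Lp 𝕜 2 ν) where
  carrier := {x | AverageConverges R ν F x}
  zero_mem' := h.averageConverges_congr (Lp.coeFn_zero 𝕜 2 ν).symm
    (h.averageConverges_of_invariant stronglyMeasurable_zero (integrable_zero _ _ _))
  add_mem' := fun {x y} hx hy => h.averageConverges_congr (Lp.coeFn_add x y).symm
    (h.averageConverges_add ((Lp.memLp x).integrable (by norm_num))
      ((Lp.memLp y).integrable (by norm_num)) hx hy)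
  smul_mem' := fun c x hx => h.averageConverges_congr (Lp.coeFn_smul c x).symm
    (averageConverges_smul c hx)

/-- On a probability space the L² norm dominates the L¹ norm, so L² approximation is an instance of
the L¹ criterion. -/
theorem isClosed_convergentSubmodule [StandardBorelSpace B] [IsProbabilityMeasure ν]
    (h : IsRegularFamily R ν g G F Cs Cd) (hCs : Cs ≠ 0) (hCs' : Cs ≠ ∞) (hCd : Cd ≠ ∞) :
    IsClosed (h.convergentSubmodule 𝕜 : Set (Lp 𝕜 2 ν)) := by
  refine isClosed_of_closure_subset fun x hx => ?_
  refine h.averageConverges_of_approx hCs hCs' hCd ((Lp.memLp x).integrable (by norm_num))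
    fun ε hε => ?_
  obtain ⟨y, hy, hxy⟩ := EMetric.mem_closure_iff.1 hx ε (pos_iff_ne_zero.2 hε)
  refine ⟨y, (Lp.memLp y).integrable (by norm_num), hy, ?_⟩
  refine (eLpNorm_le_eLpNorm_of_exponent_le (by norm_num : (1 : ℝ≥0∞) ≤ 2)
    ((Lp.aestronglyMeasurable x).sub (Lp.aestronglyMeasurable y))).trans ?_
  rw [Lp.edist_def] at hxy
  exact hxy.le

/-- Indicators of measurable sets are bounded, so their coboundaries converge; linearity and
closedness extend this to all of L². -/
theorem sub_compMeasurePreserving_mem [StandardBorelSpace B] [IsProbabilityMeasure ν]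
    (h : IsRegularFamily R ν g G F Cs Cd) (hCs : Cs ≠ 0) (hCs' : Cs ≠ ∞) (hCd : Cd ≠ ∞)
    {φ : Equiv.Perm B} (hφ : φ ∈ Inn R) (hmp : MeasurePreserving φ ν ν)
    (hlim : ∀ᵐ b ∂ν, Tendsto
      (fun n => ((symmDiff (F n b : Set B) (φ '' (F n b : Set B))).ncard : ℝ) / (F n b).card)
      atTop (𝓝 0)) (y : Lp 𝕜 2 ν) :
    y - Lp.compMeasurePreservingₗᵢ 𝕜 φ hmp y ∈ h.convergentSubmodule 𝕜 := by
  set U := Lp.compMeasurePreservingₗᵢ (p := 2) (E := 𝕜) 𝕜 φ hmp with hU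
  have hUcoe : ∀ z : Lp 𝕜 2 ν, U z =ᵐ[ν] z ∘ φ := fun z => Lp.coeFn_compMeasurePreserving z hmp
  refine Lp.induction (by norm_num : (2 : ℝ≥0∞) ≠ ∞)
    (motive := fun y => y - U y ∈ h.convergentSubmodule 𝕜) ?_ ?_ ?_ y
  · intro c s hs hμs
    rw [Lp.simpleFunc.coe_indicatorConst]
    set z := indicatorConstLp 2 hs hμs.ne c with hz
    have hzc : z =ᵐ[ν] s.indicator fun _ => c := indicatorConstLp_coeFn
    refine h.averageConverges_congr ?_ (h.averageConverges_sub_comp hφ hmp hlim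
      (q := s.indicator fun _ => c) (stronglyMeasurable_const.indicator hs) (C := ‖c‖)
      fun b => norm_indicator_le_norm_self _ _)
    filter_upwards [Lp.coeFn_sub z (U z), hUcoe z, hzc,
      hmp.quasiMeasurePreserving.ae_eq_comp hzc] with b h1 h2 h3 h4
    rw [h1, Pi.sub_apply, Pi.sub_apply, h2, h3, h4]
  · intro f f' hf hf' _ h1 h2
    have := (h.convergentSubmodule 𝕜).add_mem h1 h2
    rw [map_add]
    convert this using 1
    abel
  · exact (h.isClosed_convergentSubmodule hCs hCs' hCd).preimage
      (continuous_id.sub U.continuous)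

theorem convergentSubmodule_eq_top [StandardBorelSpace B] [IsProbabilityMeasure ν]
    (h : IsRegularFamily R ν g G F Cs Cd) (hCs : Cs ≠ 0) (hCs' : Cs ≠ ∞) (hCd : Cd ≠ ∞)
    (hν : IsInvariantMeasure R ν) {Φ : Set (Equiv.Perm B)} (hΦ : ∀ φ ∈ Φ, φ ∈ Inn R)
    (hlim : ∀ φ ∈ Φ, ∀ᵐ b ∂ν, Tendsto
      (fun n => ((symmDiff (F n b : Set B) (φ '' (F n b : Set B))).ncard : ℝ) / (F n b).card)
      atTop (𝓝 0)) (hg : ∀ i, (g i).toEquiv ∈ Subgroup.closure Φ) :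
    h.convergentSubmodule 𝕜 = ⊤ := by
  have := (h.isClosed_convergentSubmodule (𝕜 := 𝕜) hCs hCs' hCd).completeSpace_coe
  rw [← Submodule.orthogonal_eq_bot_iff, Submodule.eq_bot_iff]
  intro x hx
  rw [Submodule.mem_orthogonal] at hx
  have hinv : ∀ φ ∈ Φ, x ∘ φ =ᵐ[ν] x := by
    intro φ hφ
    have hmp := hν.measurePreserving (hΦ φ hφ)
    set U := Lp.compMeasurePreservingₗᵢ (p := 2) (E := 𝕜) 𝕜 φ hmp with hU
    have h0 := hx _ (h.sub_compMeasurePreserving_mem hCs hCs' hCd (hΦ φ hφ) hmp (hlim φ hφ) x)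
    rw [inner_sub_left, sub_eq_zero, inner_self_eq_norm_sq_to_K] at h0
    have h1 : RCLike.re (inner 𝕜 (U x) x) = ‖x‖ ^ 2 := by
      rw [← h0, ← RCLike.ofReal_pow, RCLike.ofReal_re]
    -- Orthogonality of `x` to `x - U x` gives `⟨U x, x⟩ = ‖x‖²`; as `U` is an isometry, expanding
    -- the square gives 0.
    have h2 : ‖U x - x‖ ^ 2 = 0 := by
      rw [norm_sub_sq (𝕜 := 𝕜), h1, U.norm_map]; ring
    have h3 : U x = x := sub_eq_zero.1 (norm_eq_zero.1 (pow_eq_zero_iff two_ne_zero |>.1 h2))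
    have h4 : U x =ᵐ[ν] x ∘ φ := Lp.coeFn_compMeasurePreserving x hmp
    rw [h3] at h4
    exact h4.symm
  obtain ⟨w, hw, hxw⟩ := h.cover.exists_invariant_ae_eq (Lp.aestronglyMeasurable x)
    fun i => ae_comp_eq_of_mem_closure hΦ (fun φ hφ => hν.measurePreserving hφ) hinv (hg i)
  have hxi : Integrable x ν := (Lp.memLp x).integrable (by norm_num)
  -- Being almost everywhere invariant, `x` itself has convergent averages, so it is orthogonal to
  -- itself.
  have hxM : x ∈ h.convergentSubmodule 𝕜 := h.averageConverges_congr hxw.symm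
    (h.averageConverges_of_invariant hw (hxi.congr hxw))
  exact inner_self_eq_zero.1 (hx x hxM)

end IsRegularFamily

end ErgodicRel

/-! ### Conclusion by density of L² in L¹ -/

theorem theorem2p1 {B : Type*} [MeasurableSpace B] [StandardBorelSpace B]
    (ν : Measure B) [IsProbabilityMeasure ν]
    (R : Setoid B) (hR : ErgodicRel.IsCountableBorel R)
    (hν : ErgodicRel.IsInvariantMeasure R ν)
    (F : ℕ → B → Finset B) (hF : ErgodicRel.IsBorelFamily R F)
    (hinv : ErgodicRel.IsAsymptoticallyInvariant R ν F)
    (hshr : ErgodicRel.IsNonShrinking ν F)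
    (hdbl : ErgodicRel.IsDoubling ν F)
    {𝕜 : Type*} [RCLike 𝕜] (f : B → 𝕜) (hf : Integrable f ν) :
    (∀ᵐ b ∂ν, Tendsto (fun n => ErgodicRel.average F f n b) atTop
      (𝓝 ((ν[f | ErgodicRel.invariantSigma R]) b))) ∧
    (∀ n, Integrable (ErgodicRel.average F f n) ν) ∧
    Tendsto (fun n => eLpNorm
      (fun b => ErgodicRel.average F f n b - (ν[f | ErgodicRel.invariantSigma R]) b) 1 ν)
      atTop (𝓝 0) := by
  obtain ⟨Φ, hc, hΦ, hgen, hlim⟩ := hinv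
  obtain ⟨g, G₀, hcover, hg⟩ := ErgodicRel.exists_isOrbitCover hν hc hΦ hgen
  obtain ⟨G, Cs, Cd, hCs, hCs', hCd, h⟩ := ErgodicRel.exists_isRegularFamily hcover hF hshr hdbl
  have htop := h.convergentSubmodule_eq_top (𝕜 := 𝕜) hCs hCs' hCd hν hΦ hlim hg
  have hconv : ErgodicRel.AverageConverges R ν F f := by
    refine h.averageConverges_of_approx hCs hCs' hCd hf fun ε hε => ?_
    -- Simple functions lie in L², where convergence is known, and are dense in L¹.
    obtain ⟨s, hs, hs1⟩ := (memLp_one_iff_integrable.2 hf).exists_simpleFunc_eLpNorm_sub_lt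
      ENNReal.one_ne_top hε
    have hs2 : MemLp s 2 ν := s.memLp_of_isFiniteMeasure 2 ν
    have hmem : hs2.toLp s ∈ h.convergentSubmodule 𝕜 := by rw [htop]; trivial
    exact ⟨s, memLp_one_iff_integrable.1 hs1,
      h.averageConverges_congr hs2.coeFn_toLp hmem, hs.le⟩
  exact ⟨hconv.ae_tendsto, h.integrable_average hCs hCs' hCd hf, hconv.eLpNorm_tendsto⟩
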